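/- Let $(\Omega,\mathcal F,P)$ be a probability space, $n\ge 0$, $\mathcal F_0\subseteq\cdots\subseteq\mathcal F_n$ sub-$\sigma$-fields of $\mathcal F$, and $Z_0,\dots,Z_n$ a complex-valued martingale with respect to $\mathcal F_0,\dots,\mathcal F_n$ that is almost surely bounded (there is a constant $C$ with $|Z_k|\le C$ a.s. for all $k$). Write $\mathbb E_k X=\mathbb E(X\mid\mathcal F_k)$ and $\mathbb V_k X=\mathbb E_k\bigl((X-\mathbb E_kX)^2\bigr)$ for a real or complex random variable $X$ (for complex $X$ this is the conditional pseudovariance). For an a.s. bounded real random variable $X$ with $|X|\le c$ a.s. and a $\sigma$-field $\mathcal G\subseteq\mathcal F$, put $$\operatorname{ess\,sup}(X\mid\mathcal G)=-c+\lim_{r\to\infty}\bigl(\mathbb E((X+c)^r\mid\mathcal G)\bigr)^{1/r},$$ which up to a.s. equality does not depend on $c$. For an a.s. bounded complex random variable $W$ put $$\operatorname{diam}(W\mid\mathcal G)=\sup_{\theta}\Bigl(\operatorname{ess\,sup}\bigl(\operatorname{Re}(e^{-i\theta}W)\mid\mathcal G\bigr)+\operatorname{ess\,sup}\bigl(-\operatorname{Re}(e^{-i\theta}W)\mid\mathcal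 G\bigr)\Bigr),$$ the supremum being over a countable dense set of angles $\theta\in(-\pi,\pi]$, whose choice does not matter up to a.s. equality; write $\operatorname{diam}_k W=\operatorname{diam}(W\mid\mathcal F_k)$. For $1\le k\le n$ let $$R_k=\operatorname{diam}_{k-1}Z_k,\qquad Q_k=\max\bigl\{\operatorname{diam}_{k-1}\mathbb E_k(Z_n-Z_k)^2,\ \operatorname{diam}_{k-1}\mathbb E_k(\operatorname{Re}Z_n-\operatorname{Re}Z_k)^2\bigr\}.$$ Then there are $\mathcal F_0$-measurable complex random variables $L$ and $L'$ such that, almost surely, $$\mathbb E_0e^{Z_n}=e^{Z_0+\frac12\mathbb V_0Z_n}+L\,e^{\operatorname{Re}Z_0+\frac12\mathbb V_0(\operatorname{Re}Z_n)}=e^{Z_0+\frac12\mathbb V_0Z_n}\Bigl(1+L'\,e^{\frac12\mathbb V_0(\operatorname{Im}Z_n)}\Bigr)$$ and $$|L|=|L'|\le\operatorname{ess\,sup}\Bigl(\exp\Bigl(\sum_{k=1}^n\bigl(\tfrac16R_k^3+\tfrac16R_kQ_k+\tfrac58R_k^4+\tfrac5{32}Q_k^2\bigr)\Bigr)\Bigm|\mathcal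 F_0\Bigr)-1.$$ -/

import Mathlib

open MeasureTheory ProbabilityTheory Filter Topology
open scoped ENNReal

noncomputable section

namespace ComplexMartingale

variable {Ω : Type*} {m₀ : MeasurableSpace Ω}

/-- The conditional essential supremum of an a.s. bounded real random variable `X` given the
sub-σ-field `m`: `ess sup (X | m) = -c + lim_{r → ∞} (E ((X + c) ^ r | m)) ^ (1 / r)`, where
`c` is a bound with `|X| ≤ c` a.s. We take for `c` the least such bound, which is the
`L^∞`-norm of `X`; another bound changes the function only on a null set. -/
def condEssSup (m : MeasurableSpace Ω) (P : Measure[m₀] Ω) (X : Ω → ℝ) : Ω → ℝ := fun ω =>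
  let c : ℝ := (eLpNorm X ∞ P).toReal
  limUnder atTop (fun r : ℕ => ((P[fun ω' => (X ω' + c) ^ r | m]) ω) ^ (1 / (r : ℝ))) - c

/-- The conditional diameter of an a.s. bounded complex random variable `Z` given `m`:
`sup_θ (ess sup (Re (e^{-iθ} Z) | m) + ess sup (-Re (e^{-iθ} Z) | m))`.
Conditional essential suprema are determined only up to a null set for each `θ`, so the supremum
is taken over a countable dense set of angles, the rational points of `(-π, π]`. -/
def condDiam (m : MeasurableSpace Ω) (P : Measure[m₀] Ω) (Z : Ω → ℂ) : Ω → ℝ := fun ω =>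
  ⨆ θ : {q : ℚ // (q : ℝ) ∈ Set.Ioc (-Real.pi) Real.pi},
    (condEssSup m P (fun ω' => (Complex.exp (-(Complex.I * ((θ : ℚ) : ℂ))) * Z ω').re) ω
      + condEssSup m P (fun ω' => -(Complex.exp (-(Complex.I * ((θ : ℚ) : ℂ))) * Z ω').re) ω)

/-- The conditional pseudovariance `E ((Z - E (Z | m))² | m)` of a complex random variable
(no absolute value is taken; its values are complex numbers). -/
def condPseudoVar (m : MeasurableSpace Ω) (P : Measure[m₀] Ω) (Z : Ω → ℂ) : Ω → ℂ :=
  P[fun ω => (Z ω - (P[Z | m]) ω) ^ 2 | m]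

/-- `R_k = diam (Z_k | F_{k-1})` for `1 ≤ k ≤ n`; the index `k : Fin n` stands for `k + 1`. -/
def R {n : ℕ} (P : Measure[m₀] Ω) (F : Filtration (Fin (n + 1)) m₀)
    (Z : Fin (n + 1) → Ω → ℂ) (k : Fin n) : Ω → ℝ :=
  condDiam (F k.castSucc) P (Z k.succ)

/-- `Q_k`, the larger of `diam (E ((Z_n - Z_k)² | F_k) | F_{k-1})` and
`diam (E ((Re Z_n - Re Z_k)² | F_k) | F_{k-1})`, for `1 ≤ k ≤ n`;
the index `k : Fin n` stands for `k + 1`. -/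
def Q {n : ℕ} (P : Measure[m₀] Ω) (F : Filtration (Fin (n + 1)) m₀)
    (Z : Fin (n + 1) → Ω → ℂ) (k : Fin n) : Ω → ℝ := fun ω =>
  max
    (condDiam (F k.castSucc) P
      (P[fun ω' => (Z (Fin.last n) ω' - Z k.succ ω') ^ 2 | F k.succ]) ω)
    (condDiam (F k.castSucc) P
      (fun ω'' => (((P[fun ω' => ((Z (Fin.last n) ω').re - (Z k.succ ω').re) ^ 2 | F k.succ])
        ω'' : ℝ) : ℂ)) ω)

end ComplexMartingale

end

/-! The proof is a backward recursion. Let V_k = E_k (Z_n - Z_k)^2, let V'_k be its analogue for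
real parts, let δ_k be the k-th summand of the exponent, and let T be the conditional essential
supremum of exp(∑ δ_j) given F_0. The claim is |E_k e^{Z_n} - e^{Z_k + V_k/2}| ≤ (T e^{-(δ_1 + ... +
δ_k)} - 1) e^{Re Z_k + V'_k/2}. At k = n the left side vanishes and the coefficient is nonnegative,
because T dominates exp(∑ δ_j); at k = 0 the claim is the desired bound. For k ≥ 1 the coefficient
is F_{k-1}-measurable, as δ_j is F_{j-1}-measurable, so it acts as a constant under E_{k-1}.

One step replaces E_{k-1} exp(Z_k + V_k/2) by the exponential of the conditional mean plus half the
conditional pseudovariance of Z_k, at relative cost e^{δ_k} - 1. By the law of total variance the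
new exponent is Z_{k-1} + V_{k-1}/2. The same estimate for the real parts controls the inherited
error, so a coefficient b becomes (1 + b) e^{δ_k} - 1.

Each step is an integral estimate under a regular conditional law
(`norm_integral_exp_add_sub_exp_le`). For centred X and Y of diameters R and q = Q/2, expand e^{X+Y}
to second order. Jung's theorem bounds each second moment by a third of the squared diameter, and
`remainder_le` compares the resulting function of R and q with e^δ - 1. -/

section PlanarSets

/-! ### Jung's theorem in the plane. -/

theorem sum_sum_mul_mul_sub_sq {ι : Type*} (s : Finset ι) (w a : ι → ℝ) (hw : ∑ i ∈ s, w i = 1) :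
    ∑ i ∈ s, ∑ j ∈ s, w i * w j * (a i - a j) ^ 2
      = 2 * (∑ i ∈ s, w i * a i ^ 2 - (∑ i ∈ s, w i * a i) ^ 2) := by
  have h : ∀ i ∈ s, ∑ j ∈ s, w i * w j * (a i - a j) ^ 2
      = w i * a i ^ 2 - 2 * (w i * a i) * (∑ j ∈ s, w j * a j)
        + w i * ∑ j ∈ s, w j * a j ^ 2 := by
    intro i _
    calc ∑ j ∈ s, w i * w j * (a i - a j) ^ 2
        = ∑ j ∈ s, (w i * a i ^ 2 * w j - 2 * (w i * a i) * (w j * a j)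
            + w i * (w j * a j ^ 2)) := Finset.sum_congr rfl fun j _ => by ring
      _ = _ := by
        rw [Finset.sum_add_distrib, Finset.sum_sub_distrib, ← Finset.mul_sum, ← Finset.mul_sum,
          ← Finset.mul_sum, hw, mul_one]
  rw [Finset.sum_congr rfl h, Finset.sum_add_distrib, Finset.sum_sub_distrib, ← Finset.sum_mul,
    ← Finset.sum_mul, ← Finset.mul_sum, hw]
  ring

/-- A finite family of points of the plane lies in a disc whose squared radius is the
largest weighted variance of the family. -/
theorem exists_center_of_fintype {ι : Type*} [Fintype ι] [Nonempty ι] (p : ι → ℂ) {d : ℝ}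
    (hp : ∀ i j, ‖p i - p j‖ ≤ d) :
    ∃ c, ∀ i, ‖p i - c‖ ^ 2 ≤ d ^ 2 * (1 - 1 / Fintype.card ι) / 2 := by
  classical
  let f : (ι → ℝ) → ℝ := fun w => ∑ i, w i * ‖p i‖ ^ 2
    - (∑ i, w i * (p i).re) ^ 2 - (∑ i, w i * (p i).im) ^ 2
  have hf : Continuous f := by fun_prop
  obtain ⟨w, hw, hmax⟩ := (isCompact_stdSimplex ℝ ι).exists_isMaxOn
    ⟨_, single_mem_stdSimplex ℝ (Classical.arbitrary ι)⟩ hf.continuousOn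
  have hcard : (0 : ℝ) < Fintype.card ι := by exact_mod_cast Fintype.card_pos
  have hfw : f w ≤ d ^ 2 * (1 - 1 / Fintype.card ι) / 2 := by
    have e : 2 * f w = ∑ i, ∑ j, w i * w j * ‖p i - p j‖ ^ 2 := by
      have h1 := sum_sum_mul_mul_sub_sq Finset.univ w (fun i => (p i).re) hw.2
      have h2 := sum_sum_mul_mul_sub_sq Finset.univ w (fun i => (p i).im) hw.2
      have h3 : ∑ i, ∑ j, w i * w j * ‖p i - p j‖ ^ 2
          = ∑ i, ∑ j, w i * w j * ((p i).re - (p j).re) ^ 2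
            + ∑ i, ∑ j, w i * w j * ((p i).im - (p j).im) ^ 2 := by
        simp_rw [← Finset.sum_add_distrib]
        refine Finset.sum_congr rfl fun i _ => Finset.sum_congr rfl fun j _ => ?_
        rw [Complex.sq_norm, Complex.normSq_apply, Complex.sub_re, Complex.sub_im]
        ring
      have h4 : ∑ i, w i * ‖p i‖ ^ 2
          = ∑ i, w i * (p i).re ^ 2 + ∑ i, w i * (p i).im ^ 2 := by
        rw [← Finset.sum_add_distrib]
        refine Finset.sum_congr rfl fun i _ => ?_
        rw [Complex.sq_norm, Complex.normSq_apply]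
        ring
      rw [h3, h1, h2]
      simp only [f, h4]
      ring
    -- The diagonal terms vanish, which saves d^2 ∑ w_i^2; by Cauchy–Schwarz this is at least d^2 /
    -- N for N points.
    have h5 : ∑ i, ∑ j, w i * w j * ‖p i - p j‖ ^ 2
        ≤ ∑ i, ∑ j, (w i * w j * d ^ 2 - if i = j then w i * w j * d ^ 2 else 0) := by
      refine Finset.sum_le_sum fun i _ => Finset.sum_le_sum fun j _ => ?_
      split_ifs with h
      · simp [h]
      · rw [sub_zero]
        exact mul_le_mul_of_nonneg_left
          (pow_le_pow_left₀ (norm_nonneg _) (hp i j) 2) (mul_nonneg (hw.1 i) (hw.1 j))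
    have h6 : ∑ i, ∑ j, (w i * w j * d ^ 2 - if i = j then w i * w j * d ^ 2 else 0)
        = d ^ 2 * (1 - ∑ i, w i ^ 2) := by
      simp only [Finset.sum_sub_distrib, Finset.sum_ite_eq, Finset.mem_univ, if_true]
      rw [mul_sub, mul_one, Finset.mul_sum]
      congr 1
      · simp_rw [← Finset.sum_mul, ← Finset.mul_sum, hw.2, mul_one, hw.2, one_mul]
      · exact Finset.sum_congr rfl fun i _ => by ring
    have h7 : 1 / (Fintype.card ι : ℝ) ≤ ∑ i, w i ^ 2 := by
      have := sq_sum_le_card_mul_sum_sq (s := Finset.univ) (f := w)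
      rw [hw.2, Finset.card_univ] at this
      rw [div_le_iff₀ hcard]
      linarith
    nlinarith [sq_nonneg d]
  refine ⟨⟨∑ i, w i * (p i).re, ∑ i, w i * (p i).im⟩, fun j => le_trans ?_ hfw⟩
  set c : ℂ := ⟨∑ i, w i * (p i).re, ∑ i, w i * (p i).im⟩ with hc
  -- Moving mass t from the maximiser to the vertex j gives the variance (1 - t) f(w) + t (1 - t)
  -- |p_j - c|^2. Maximality of w, division by t and t → 0 then bound |p_j - c|^2 by f(w).
  have key : ∀ t ∈ Set.Ioo (0 : ℝ) 1, (1 - t) * ‖p j - c‖ ^ 2 ≤ f w := by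
    intro t ht
    let u : ι → ℝ := (1 - t) • w + t • Pi.single j 1
    have hmem : u ∈ stdSimplex ℝ ι :=
      convex_stdSimplex ℝ ι hw (single_mem_stdSimplex ℝ j) (by linarith [ht.2]) ht.1.le (by ring)
    have h1 := hmax hmem
    have hs : ∀ a : ι → ℝ, ∑ i, u i * a i
        = (1 - t) * ∑ i, w i * a i + t * a j := by
      intro a
      simp only [u, Pi.add_apply, Pi.smul_apply, smul_eq_mul, add_mul, Finset.sum_add_distrib,
        Finset.mul_sum, mul_assoc]
      congr 1
      simp [Pi.single_apply]
    have h2 : f u = (1 - t) * f w + t * (1 - t) * ‖p j - c‖ ^ 2 := by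
      simp only [f, hs]
      rw [Complex.sq_norm (p j - c), Complex.normSq_apply, Complex.sub_re, Complex.sub_im,
        Complex.sq_norm (p j), Complex.normSq_apply, hc]
      ring
    have h3 : f u ≤ f w := h1
    have h4 : t * ((1 - t) * ‖p j - c‖ ^ 2) ≤ t * f w := by linarith
    exact le_of_mul_le_mul_left h4 ht.1
  have hlim : Tendsto (fun t : ℝ => (1 - t) * ‖p j - c‖ ^ 2) (𝓝[>] 0) (𝓝 ((1 - 0) * ‖p j - c‖ ^ 2)) :=
    (Continuous.tendsto (by fun_prop) 0).mono_left nhdsWithin_le_nhds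
  rw [sub_zero, one_mul] at hlim
  exact le_of_tendsto hlim (by
    filter_upwards [Ioo_mem_nhdsGT (zero_lt_one' ℝ)] with t ht using key t ht)

/-- **Jung's theorem** in the plane. -/
theorem exists_center_of_norm_sub_le {S : Set ℂ} {d : ℝ}
    (hS : ∀ x ∈ S, ∀ y ∈ S, ‖x - y‖ ≤ d) : ∃ c, ∀ x ∈ S, ‖x - c‖ ^ 2 ≤ d ^ 2 / 3 := by
  -- A centre is a common point of the discs of radius d/√3 around the points of S. By Helly it
  -- suffices to treat at most three discs, where the finite case gives d^2 (1 - 1/3) / 2 = d^2 / 3.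
  have h := Convex.helly_theorem_compact' (𝕜 := ℝ) (E := ℂ)
    (F := fun x : S => Metric.closedBall (x : ℂ) (Real.sqrt (d ^ 2 / 3)))
    (fun x => convex_closedBall _ _) (fun x => isCompact_closedBall _ _) ?_
  · obtain ⟨c, hc⟩ := h
    refine ⟨c, fun x hx => ?_⟩
    have := Set.mem_iInter.1 hc ⟨x, hx⟩
    rw [Metric.mem_closedBall, dist_comm, dist_eq_norm] at this
    calc ‖x - c‖ ^ 2 ≤ Real.sqrt (d ^ 2 / 3) ^ 2 := pow_le_pow_left₀ (norm_nonneg _) this 2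
      _ = d ^ 2 / 3 := Real.sq_sqrt (by positivity)
  · intro I hI
    rw [Complex.finrank_real_complex] at hI
    rcases I.eq_empty_or_nonempty with rfl | hne
    · simp
    have : Nonempty I := hne.to_subtype
    obtain ⟨c, hc⟩ := exists_center_of_fintype (fun i : I => ((i : S) : ℂ))
      (fun i j => hS _ (i : S).2 _ (j : S).2)
    refine ⟨c, Set.mem_iInter₂.2 fun i hi => ?_⟩
    rw [Metric.mem_closedBall, dist_comm, dist_eq_norm]
    refine Real.le_sqrt_of_sq_le ((hc ⟨i, hi⟩).trans ?_)
    have hI' : (Fintype.card I : ℝ) ≤ 3 := by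
      rw [Fintype.card_coe]; exact_mod_cast hI
    have hpos : (0 : ℝ) < Fintype.card I := by exact_mod_cast Fintype.card_pos
    have : 1 / 3 ≤ 1 / (Fintype.card I : ℝ) := one_div_le_one_div_of_le hpos hI'
    nlinarith [sq_nonneg d]

end PlanarSets

/-! ### Numerical inequalities for the exponential. -/

section ExponentialEstimates

/-- The tail of the exponential series divided by x^k is a power series with nonnegative
coefficients, hence increasing on x ≥ 0. The product form avoids dividing by zero. -/
theorem pow_mul_exp_sub_sum_le {s t : ℝ} (ht : 0 ≤ t) (hts : t ≤ s) {k n : ℕ} (hkn : k ≤ n) :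
    s ^ k * (Real.exp t - ∑ i ∈ Finset.range n, t ^ i / i.factorial)
      ≤ t ^ k * (Real.exp s - ∑ i ∈ Finset.range n, s ^ i / i.factorial) := by
  have h : ∀ x : ℝ, HasSum (fun i => x ^ (i + n) / ((i + n).factorial : ℝ))
      (Real.exp x - ∑ i ∈ Finset.range n, x ^ i / i.factorial) := fun x => by
    have := NormedSpace.expSeries_div_hasSum_exp x
    rw [← Real.exp_eq_exp_ℝ] at this
    exact (hasSum_nat_add_iff' n).2 this
  refine hasSum_le (fun i => ?_) ((h t).mul_left (s ^ k)) ((h s).mul_left (t ^ k))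
  obtain ⟨m, rfl⟩ := Nat.exists_eq_add_of_le hkn
  have e : ∀ x : ℝ, x ^ (i + (k + m)) = x ^ k * x ^ (i + m) := fun x => by
    rw [← pow_add]; congr 1; ring
  rw [← mul_div_assoc, ← mul_div_assoc, e, e]
  have := pow_le_pow_left₀ ht hts (i + m)
  gcongr ?_ / _
  calc s ^ k * (t ^ k * t ^ (i + m)) = s ^ k * t ^ k * t ^ (i + m) := by ring
    _ ≤ s ^ k * t ^ k * s ^ (i + m) := by
      have := ht.trans hts
      gcongr
    _ = _ := by ring

theorem exp_remainder_two_le {s t : ℝ} (ht : 0 ≤ t) (hts : t ≤ s) :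
    s ^ 2 * (Real.exp t - 1 - t - t ^ 2 / 2) ≤ t ^ 2 * (Real.exp s - 1 - s - s ^ 2 / 2) := by
  have := pow_mul_exp_sub_sum_le ht hts (k := 2) (n := 3) (by norm_num)
  simp only [Finset.sum_range_succ, Finset.sum_range_zero, Nat.factorial] at this
  norm_num at this
  convert this using 2 <;> ring

theorem exp_remainder_three_le {s t : ℝ} (ht : 0 ≤ t) (hts : t ≤ s) :
    s ^ 3 * (Real.exp t - 1 - t - t ^ 2 / 2) ≤ t ^ 3 * (Real.exp s - 1 - s - s ^ 2 / 2) := by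
  have := pow_mul_exp_sub_sum_le ht hts (k := 3) (n := 3) (by norm_num)
  simp only [Finset.sum_range_succ, Finset.sum_range_zero, Nat.factorial] at this
  norm_num at this
  convert this using 2 <;> ring

/-- Follows from e^x ≤ 1/(1 - x). The threshold 3/8 is the largest value of R^2/6 for R ≤ 3/2. -/
theorem exp_sub_one_sub_le_sq {x : ℝ} (hx1 : x ≤ 3 / 8) :
    Real.exp x - 1 - x ≤ 8 / 5 * x ^ 2 := by
  have h := Real.one_sub_le_exp_neg x
  have h1 : Real.exp x * (1 - x) ≤ 1 := by
    calc Real.exp x * (1 - x) ≤ Real.exp x * Real.exp (-x) := by gcongr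
      _ = 1 := by rw [← Real.exp_add]; simp
  nlinarith [Real.add_one_le_exp x, sq_nonneg x]

theorem norm_exp_sub_le (z : ℂ) :
    ‖Complex.exp z - 1 - z - z ^ 2 / 2‖ ≤ Real.exp ‖z‖ - 1 - ‖z‖ - ‖z‖ ^ 2 / 2 := by
  have := Complex.norm_exp_sub_sum_le_exp_norm_sub_sum z 3
  simp only [Finset.sum_range_succ, Finset.sum_range_zero, Nat.factorial] at this
  norm_num at this
  simpa only [← sub_sub] using this

theorem norm_exp_sub_one_sub_le (z : ℂ) :
    ‖Complex.exp z - 1 - z‖ ≤ Real.exp ‖z‖ - 1 - ‖z‖ := by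
  have := Complex.norm_exp_sub_sum_le_exp_norm_sub_sum z 2
  simp only [Finset.sum_range_succ, Finset.sum_range_zero, Nat.factorial] at this
  norm_num at this
  simpa only [← sub_sub] using this

/-- The exponent attached to the bound `R` for the diameter of the increment and
the bound `q` for the diameter of half the pseudovariance. -/
noncomputable def errorExponent (R q : ℝ) : ℝ :=
  R ^ 3 / 6 + R * q / 3 + 5 / 8 * R ^ 4 + 5 / 8 * q ^ 2

theorem errorExponent_nonneg {R q : ℝ} (hR : 0 ≤ R) (hq : 0 ≤ q) : 0 ≤ errorExponent R q := by
  unfold errorExponent; positivity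

theorem exp_three_halves_lt : Real.exp (3 / 2) < 4.49 := by
  have h1 : Real.exp (3 / 2) ^ 2 = Real.exp 1 ^ 3 := by
    rw [← Real.exp_nat_mul, ← Real.exp_nat_mul]; norm_num
  have h2 : Real.exp 1 ^ 3 < 4.49 ^ 2 := by
    calc Real.exp 1 ^ 3 < 2.7182818286 ^ 3 := by
          gcongr; exact Real.exp_one_lt_d9
      _ < _ := by norm_num
  rw [← h1] at h2
  exact lt_of_pow_lt_pow_left₀ 2 (by norm_num) h2

/-- For small s = R + q the cubic remainder is at most its value at 3/2 scaled by (s / (3/2))^3, and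
(4.49 - 3.625) / 1.5^3 < 0.257. Here even the exponent itself, not only e^δ - 1, is large enough. -/
theorem remainder_le_of_add_le {R q : ℝ} (hR : 0 ≤ R) (hq : 0 ≤ q) (h : R + q ≤ 3 / 2) :
    (Real.exp (R + q) - 1 - (R + q) - (R + q) ^ 2 / 2) / 3 + R * q / 3 + q ^ 2 / 6
      + (Real.exp (R ^ 2 / 6) - 1 - R ^ 2 / 6) ≤ errorExponent R q := by
  have h1 := exp_remainder_three_le (add_nonneg hR hq) h
  have h2 := exp_sub_one_sub_le_sq (x := R ^ 2 / 6) (by nlinarith)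
  have h3 := exp_three_halves_lt
  have h4 : Real.exp (R + q) - 1 - (R + q) - (R + q) ^ 2 / 2 ≤ 0.257 * (R + q) ^ 3 := by
    have : 0 ≤ (R + q) ^ 3 := by positivity
    nlinarith
  unfold errorExponent
  -- The coefficients 0.58 and 0.458 leave room below 5/8 for (8/5)/36 from the R^4 term of `h2` and
  -- for 1/6 from q^2/6.
  have h5 : (0.0857 : ℝ) * (R + q) ^ 3 ≤ R ^ 3 / 6 + 0.58 * R ^ 4 + 0.458 * q ^ 2 := by
    have e : (R + q) ^ 3 = R ^ 3 + 3 * (R ^ 2 * q) + q ^ 2 * (3 * R + q) := by ring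
    have a1 : q ^ 2 * (3 * R + q) ≤ q ^ 2 * 4.5 :=
      mul_le_mul_of_nonneg_left (by linarith) (sq_nonneg q)
    have a2 : 0.2571 * (R ^ 2 * q) ≤ 0.5 * R ^ 4 + 0.0413 * q ^ 2 := by
      nlinarith [sq_nonneg (R ^ 2 - 0.2571 * q), sq_nonneg q, pow_nonneg hR 4]
    have := pow_nonneg hR 3
    have := pow_nonneg hR 4
    nlinarith [sq_nonneg q]
  nlinarith

/-- For large s = R + q the exponent exceeds s - 9/10, so a third of e^s costs at most 0.824 e^D.
The quadratic terms combine through s^2/6, and only e^x - 2x with x = R^2/6 is left to absorb. -/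
theorem remainder_le_of_le_add {R q : ℝ} (hR : 0 ≤ R) (hq : 0 ≤ q) (h : 3 / 2 ≤ R + q) :
    (Real.exp (R + q) - 1 - (R + q) - (R + q) ^ 2 / 2) / 3 + R * q / 3 + q ^ 2 / 6
      + (Real.exp (R ^ 2 / 6) - 1 - R ^ 2 / 6) ≤ Real.exp (errorExponent R q) - 1 := by
  set D := errorExponent R q with hD
  have hs : R + q ≤ D + 9 / 10 := by
    have : 0 ≤ R * q := mul_nonneg hR hq
    have h1 : R ≤ R ^ 3 / 6 + 5 / 8 * R ^ 4 + 1 / 2 := by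
      nlinarith [sq_nonneg (R ^ 2 - 47 / 100), sq_nonneg (R - 68 / 100), pow_nonneg hR 3,
        mul_nonneg hR (sq_nonneg (R - 68 / 100))]
    have h2 : q ≤ 5 / 8 * q ^ 2 + 4 / 10 := by nlinarith [sq_nonneg (q - 8 / 10)]
    simp only [hD, errorExponent]
    linarith
  have he : Real.exp (R + q) ≤ 2.472 * Real.exp D := by
    have h1 : Real.exp (9 / 10) ≤ 2.472 := by
      have h2 : Real.exp (9 / 10) * Real.exp (1 / 10) = Real.exp 1 := by
        rw [← Real.exp_add]; norm_num
      have h3 := Real.add_one_le_exp (1 / 10)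
      have h4 := Real.exp_one_lt_d9
      nlinarith [Real.exp_pos (9 / 10)]
    calc Real.exp (R + q) ≤ Real.exp (D + 9 / 10) := Real.exp_le_exp.2 hs
      _ = Real.exp (9 / 10) * Real.exp D := by rw [add_comm, Real.exp_add]
      _ ≤ _ := by gcongr
  have hD1 : 1 + D ≤ Real.exp D := by linarith [Real.add_one_le_exp D]
  suffices hx : Real.exp (R ^ 2 / 6) - 2 * (R ^ 2 / 6) ≤ 0.176 * Real.exp D + 0.833 by
    linarith [show (R + q) ^ 2 / 2 / 3 = R ^ 2 / 6 + R * q / 3 + q ^ 2 / 6 by ring]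
  rcases le_total (R ^ 2 / 6) 1 with hx | hx
  · have h1 := Real.abs_exp_sub_one_sub_id_le (x := R ^ 2 / 6)
      (by rw [abs_of_nonneg (by positivity)]; exact hx)
    have h2 := (abs_le.1 h1).2
    have h3 : (R ^ 2 / 6) ^ 2 ≤ R ^ 2 / 6 := by nlinarith [sq_nonneg R]
    linarith
  · have h1 : R ^ 2 / 6 + 2 ≤ D := by
      have a1 : (R ^ 2 / 6) * 1 ≤ (R ^ 2 / 6) * (R ^ 2 / 6) := by gcongr
      have : 0 ≤ R ^ 3 := by positivity
      have : 0 ≤ R * q := mul_nonneg hR hq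
      simp only [hD, errorExponent]
      nlinarith [sq_nonneg q]
    have h2 : 7 * Real.exp (R ^ 2 / 6) ≤ Real.exp D := by
      calc 7 * Real.exp (R ^ 2 / 6) ≤ Real.exp 2 * Real.exp (R ^ 2 / 6) := by
            gcongr
            have := Real.exp_one_gt_d9
            have e : Real.exp 2 = Real.exp 1 * Real.exp 1 := by rw [← Real.exp_add]; norm_num
            nlinarith
        _ = Real.exp (R ^ 2 / 6 + 2) := by rw [add_comm, Real.exp_add]
        _ ≤ _ := Real.exp_le_exp.2 h1
    linarith

theorem remainder_le {R q : ℝ} (hR : 0 ≤ R) (hq : 0 ≤ q) :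
    (Real.exp (R + q) - 1 - (R + q) - (R + q) ^ 2 / 2) / 3 + R * q / 3 + q ^ 2 / 6
      + (Real.exp (R ^ 2 / 6) - 1 - R ^ 2 / 6) ≤ Real.exp (errorExponent R q) - 1 := by
  rcases le_total (R + q) (3 / 2) with h | h
  · have := remainder_le_of_add_le hR hq h
    linarith [Real.add_one_le_exp (errorExponent R q)]
  · exact remainder_le_of_le_add hR hq h

end ExponentialEstimates

/-! ### Centred bounded variables and the one-step estimate for integrals. -/

theorem integrable_norm_sq {α : Type*} {mα : MeasurableSpace α} {μ : Measure α}
    [IsFiniteMeasure μ] {X : α → ℂ} {R : ℝ} (hX : AEStronglyMeasurable X μ)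
    (hb : ∀ᵐ a ∂μ, ‖X a‖ ≤ R) : Integrable (fun a => ‖X a‖ ^ 2) μ := by
  refine Integrable.of_bound (hX.norm.pow 2) (R ^ 2) ?_
  filter_upwards [hb] with a ha
  rw [Real.norm_of_nonneg (by positivity)]
  exact pow_le_pow_left₀ (norm_nonneg _) ha 2

section CentredVariables

variable {α : Type*} {mα : MeasurableSpace α} {μ : Measure α} [IsProbabilityMeasure μ]
  {S : Set α} {X Y : α → ℂ} {R q : ℝ}

theorem ae_norm_sub_integral_le (hXi : Integrable X μ) (hS : ∀ᵐ a ∂μ, a ∈ S)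
    (hX : ∀ a ∈ S, ∀ b ∈ S, ‖X a - X b‖ ≤ R) : ∀ᵐ a ∂μ, ‖X a - ∫ b, X b ∂μ‖ ≤ R := by
  filter_upwards [hS] with a ha
  have e : X a - ∫ b, X b ∂μ = ∫ b, (X a - X b) ∂μ := by
    rw [integral_sub (integrable_const _) hXi]; simp
  rw [e]
  have := norm_integral_le_of_norm_le_const (μ := μ) (f := fun b => X a - X b) (C := R) (by
    filter_upwards [hS] with b hb using hX a ha b hb)
  simpa using this

/-- The variance of a complex random variable whose values have mutual distances at most `R` is
at most `R ^ 2 / 3`. -/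
theorem integral_norm_sq_le (hX0 : ∫ a, X a ∂μ = 0) (hXi : Integrable X μ)
    (hS : ∀ᵐ a ∂μ, a ∈ S) (hX : ∀ a ∈ S, ∀ b ∈ S, ‖X a - X b‖ ≤ R) :
    ∫ a, ‖X a‖ ^ 2 ∂μ ≤ R ^ 2 / 3 := by
  obtain ⟨c, hc⟩ := exists_center_of_norm_sub_le (S := X '' S) (d := R) (by
    rintro _ ⟨a, ha, rfl⟩ _ ⟨b, hb, rfl⟩
    exact hX a ha b hb)
  have hb : ∀ᵐ a ∂μ, ‖X a‖ ≤ R := by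
    simpa [hX0] using ae_norm_sub_integral_le hXi hS hX
  have hi2 : Integrable (fun a => ‖X a‖ ^ 2) μ := integrable_norm_sq hXi.1 hb
  have hre : ∫ a, (X a).re ∂μ = 0 := by
    have := integral_re hXi
    simpa [hX0] using this
  have him : ∫ a, (X a).im ∂μ = 0 := by
    have := integral_im hXi
    simpa [hX0] using this
  have hrei : Integrable (fun a => (X a).re) μ := hXi.re
  have himi : Integrable (fun a => (X a).im) μ := hXi.im
  -- The left side is |X - c|^2 - |c|^2 with c the Jung centre; its linear part integrates to zero
  -- because X is centred.
  have hle : ∀ᵐ a ∂μ, ‖X a‖ ^ 2 - (2 * c.re * (X a).re + 2 * c.im * (X a).im)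
      ≤ R ^ 2 / 3 := by
    filter_upwards [hS] with a ha
    have := hc _ ⟨a, ha, rfl⟩
    rw [Complex.sq_norm, Complex.normSq_apply, Complex.sub_re, Complex.sub_im] at this
    rw [Complex.sq_norm, Complex.normSq_apply]
    nlinarith [sq_nonneg c.re, sq_nonneg c.im]
  have hlin : Integrable (fun a => 2 * c.re * (X a).re + 2 * c.im * (X a).im) μ :=
    (hrei.const_mul _).add (himi.const_mul _)
  have := integral_mono_ae (hi2.sub hlin) (integrable_const (R ^ 2 / 3)) hle
  simp only [Pi.sub_apply] at this
  rw [integral_sub hi2 hlin, integral_add (hrei.const_mul _) (himi.const_mul _),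
    integral_const_mul, integral_const_mul, hre, him] at this
  simpa using this

/-- Cauchy–Schwarz in the form 2Rq|XY| ≤ q^2 |X|^2 + R^2 |Y|^2, divided by 2Rq; if Rq = 0 the
product vanishes almost everywhere. -/
theorem norm_integral_mul_le (hR : 0 ≤ R) (hq : 0 ≤ q)
    (hXm : AEStronglyMeasurable X μ) (hYm : AEStronglyMeasurable Y μ)
    (hXb : ∀ᵐ a ∂μ, ‖X a‖ ≤ R) (hYb : ∀ᵐ a ∂μ, ‖Y a‖ ≤ q)
    (hX2 : ∫ a, ‖X a‖ ^ 2 ∂μ ≤ R ^ 2 / 3) (hY2 : ∫ a, ‖Y a‖ ^ 2 ∂μ ≤ q ^ 2 / 3) :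
    ‖∫ a, X a * Y a ∂μ‖ ≤ R * q / 3 := by
  have hle : ∀ᵐ a ∂μ, ‖X a * Y a‖ ≤ R * q := by
    filter_upwards [hXb, hYb] with a h1 h2
    rw [norm_mul]
    gcongr
  have hXY : Integrable (fun a => X a * Y a) μ := Integrable.of_bound (hXm.mul hYm) _ hle
  rcases (mul_nonneg hR hq).eq_or_lt with h0 | h0
  · have := norm_integral_le_of_norm_le_const hle
    rw [← h0] at this ⊢
    simpa using this
  · have h1 : 2 * (R * q) * ∫ a, ‖X a * Y a‖ ∂μ
        ≤ q ^ 2 * ∫ a, ‖X a‖ ^ 2 ∂μ + R ^ 2 * ∫ a, ‖Y a‖ ^ 2 ∂μ := by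
      rw [← integral_const_mul, ← integral_const_mul, ← integral_const_mul,
        ← integral_add ((integrable_norm_sq hXm hXb).const_mul _) ((integrable_norm_sq hYm hYb).const_mul _)]
      refine integral_mono (hXY.norm.const_mul _)
        (((integrable_norm_sq hXm hXb).const_mul _).add ((integrable_norm_sq hYm hYb).const_mul _)) fun a => ?_
      simp only [norm_mul]
      nlinarith [sq_nonneg (q * ‖X a‖ - R * ‖Y a‖)]
    have h2 : 2 * (R * q) * ∫ a, ‖X a * Y a‖ ∂μ ≤ 2 * (R * q) * (R * q / 3) := by
      nlinarith [mul_le_mul_of_nonneg_left hX2 (sq_nonneg q),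
        mul_le_mul_of_nonneg_left hY2 (sq_nonneg R)]
    exact (norm_integral_le_integral_norm _).trans (le_of_mul_le_mul_left h2 (by positivity))

theorem exp_remainder_le_mul_sq {s t : ℝ} (ht : 0 ≤ t) (hts : t ≤ s) :
    Real.exp t - 1 - t - t ^ 2 / 2 ≤ (Real.exp s - 1 - s - s ^ 2 / 2) / s ^ 2 * t ^ 2 := by
  rcases ht.eq_or_lt with rfl | h
  · simp
  · have hs : 0 < s := h.trans_le hts
    rw [div_mul_eq_mul_div, le_div_iff₀ (by positivity)]
    linarith [exp_remainder_two_le ht hts]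

theorem norm_integral_exp_add_sub_exp_le (hXi : Integrable X μ) (hYi : Integrable Y μ)
    (hX0 : ∫ a, X a ∂μ = 0) (hY0 : ∫ a, Y a ∂μ = 0) (hS : ∀ᵐ a ∂μ, a ∈ S)
    (hX : ∀ a ∈ S, ∀ b ∈ S, ‖X a - X b‖ ≤ R) (hY : ∀ a ∈ S, ∀ b ∈ S, ‖Y a - Y b‖ ≤ q) :
    ‖∫ a, Complex.exp (X a + Y a) ∂μ - Complex.exp (1 / 2 * ∫ a, X a ^ 2 ∂μ)‖
      ≤ Real.exp (errorExponent R q) - 1 := by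
  obtain ⟨a₀, ha₀⟩ := hS.exists
  have hR : 0 ≤ R := (norm_nonneg _).trans (hX a₀ ha₀ a₀ ha₀)
  have hq : 0 ≤ q := (norm_nonneg _).trans (hY a₀ ha₀ a₀ ha₀)
  have hXb : ∀ᵐ a ∂μ, ‖X a‖ ≤ R := by simpa [hX0] using ae_norm_sub_integral_le hXi hS hX
  have hYb : ∀ᵐ a ∂μ, ‖Y a‖ ≤ q := by simpa [hY0] using ae_norm_sub_integral_le hYi hS hY
  have hX2 := integral_norm_sq_le hX0 hXi hS hX
  have hY2 := integral_norm_sq_le hY0 hYi hS hY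
  set s := R + q with hs
  set A : α → ℂ := fun a => X a + Y a with hA
  have hAi : Integrable A μ := hXi.add hYi
  have hA0 : ∫ a, A a ∂μ = 0 := by rw [hA, integral_add hXi hYi, hX0, hY0, add_zero]
  have hAS : ∀ a ∈ S, ∀ b ∈ S, ‖A a - A b‖ ≤ s := fun a ha b hb => by
    calc ‖A a - A b‖ = ‖(X a - X b) + (Y a - Y b)‖ := by simp only [hA]; congr 1; ring
      _ ≤ s := (norm_add_le _ _).trans (add_le_add (hX a ha b hb) (hY a ha b hb))
  have hAb : ∀ᵐ a ∂μ, ‖A a‖ ≤ s := by simpa [hA0] using ae_norm_sub_integral_le hAi hS hAS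
  have hA2 := integral_norm_sq_le hA0 hAi hS hAS
  have hmul : ∀ {U V : α → ℂ} {u v : ℝ}, Integrable U μ → Integrable V μ →
      (∀ᵐ a ∂μ, ‖U a‖ ≤ u) → (∀ᵐ a ∂μ, ‖V a‖ ≤ v) → Integrable (fun a => U a * V a) μ := by
    intro U V u v hU hV hu hv
    refine Integrable.of_bound (hU.1.mul hV.1) (u * v) ?_
    filter_upwards [hu, hv] with a h1 h2
    rw [norm_mul]
    exact mul_le_mul h1 h2 (norm_nonneg _) ((norm_nonneg _).trans h1)
  have iXX := hmul hXi hXi hXb hXb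
  have iXY := hmul hXi hYi hXb hYb
  have iYY := hmul hYi hYi hYb hYb
  have iexp : Integrable (fun a => Complex.exp (A a)) μ := by
    refine Integrable.of_bound (Complex.continuous_exp.comp_aestronglyMeasurable hAi.1)
      (Real.exp s) ?_
    filter_upwards [hAb] with a ha
    exact (Complex.norm_exp_le_exp_norm _).trans (Real.exp_le_exp.2 ha)
  -- The remainder over t^2 is increasing, so it is dominated pointwise by a multiple of |A|^2.
  -- Integrating this, rather than using |A| ≤ s alone, gains the factor 1/3.
  have hrem : ‖∫ a, (Complex.exp (A a) - 1 - A a - A a ^ 2 / 2) ∂μ‖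
      ≤ (Real.exp s - 1 - s - s ^ 2 / 2) / 3 := by
    set g := Real.exp s - 1 - s - s ^ 2 / 2 with hg
    have hg0 : 0 ≤ g := by
      have := Real.quadratic_le_exp_of_nonneg (x := s) (by positivity)
      rw [hg]
      linarith
    have iAA := integrable_norm_sq hAi.1 hAb
    calc _ ≤ ∫ a, g / s ^ 2 * ‖A a‖ ^ 2 ∂μ := by
          refine norm_integral_le_of_norm_le (iAA.const_mul _) ?_
          filter_upwards [hAb] with a ha
          exact (norm_exp_sub_le _).trans (exp_remainder_le_mul_sq (norm_nonneg _) ha)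
      _ = g / s ^ 2 * ∫ a, ‖A a‖ ^ 2 ∂μ := integral_const_mul _ _
      _ ≤ g / s ^ 2 * (s ^ 2 / 3) := by gcongr
      _ ≤ g / 3 := by
        rcases eq_or_ne s 0 with h | h
        · rw [h]; simp; positivity
        · apply le_of_eq; field_simp
  have hXX : ‖∫ a, X a ^ 2 ∂μ‖ ≤ R ^ 2 / 3 := by
    refine (norm_integral_le_integral_norm _).trans ?_
    simpa only [norm_pow] using hX2
  have hYY : ‖∫ a, Y a ^ 2 ∂μ‖ ≤ q ^ 2 / 3 := by
    refine (norm_integral_le_integral_norm _).trans ?_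
    simpa only [norm_pow] using hY2
  have hXY := norm_integral_mul_le hR hq hXi.1 hYi.1 hXb hYb hX2 hY2
  set v := ∫ a, X a ^ 2 ∂μ with hv
  set w := ∫ a, X a * Y a ∂μ with hw
  set z := ∫ a, Y a ^ 2 ∂μ with hz
  have iX2 : Integrable (fun a => X a ^ 2) μ := by simpa only [sq] using iXX
  have iY2 : Integrable (fun a => Y a ^ 2) μ := by simpa only [sq] using iYY
  have hint : ∫ a, (Complex.exp (A a) - 1 - A a - A a ^ 2 / 2) ∂μ
      = ∫ a, Complex.exp (A a) ∂μ - 1 - (1 / 2 * v + w + 1 / 2 * z) := by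
    have e : (fun a => Complex.exp (A a) - 1 - A a - A a ^ 2 / 2)
        = fun a => Complex.exp (A a) - 1 - A a
          - (1 / 2 * X a ^ 2 + X a * Y a + 1 / 2 * Y a ^ 2) := by
      funext a; simp only [hA]; ring
    rw [e, integral_sub, integral_sub, integral_sub iexp (integrable_const _), hA0,
      integral_add, integral_add (iX2.const_mul _) iXY, integral_const_mul, integral_const_mul]
    · simp [v, w, z]
    · exact (iX2.const_mul _).add iXY
    · exact iY2.const_mul _
    · exact iexp.sub (integrable_const _)
    · exact hAi
    · exact (iexp.sub (integrable_const _)).sub hAi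
    · exact ((iX2.const_mul _).add iXY).add (iY2.const_mul _)
  have hexp : ‖Complex.exp (1 / 2 * v) - 1 - 1 / 2 * v‖
      ≤ Real.exp (R ^ 2 / 6) - 1 - R ^ 2 / 6 := by
    have h1 := norm_exp_sub_one_sub_le (1 / 2 * v)
    have h2 : ‖1 / 2 * v‖ ≤ R ^ 2 / 6 := by
      rw [norm_mul]; norm_num; linarith
    refine h1.trans ?_
    have h3 := Real.add_one_le_exp (R ^ 2 / 6 - ‖1 / 2 * v‖)
    have h4 : Real.exp (R ^ 2 / 6) = Real.exp ‖1 / 2 * v‖ * Real.exp (R ^ 2 / 6 - ‖1 / 2 * v‖) := by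
      rw [← Real.exp_add]; congr 1; ring
    have h5 := Real.one_le_exp (norm_nonneg (1 / 2 * v))
    nlinarith
  have etot : ∫ a, Complex.exp (A a) ∂μ - Complex.exp (1 / 2 * v)
      = ∫ a, (Complex.exp (A a) - 1 - A a - A a ^ 2 / 2) ∂μ + w + 1 / 2 * z
        - (Complex.exp (1 / 2 * v) - 1 - 1 / 2 * v) := by
    rw [hint]; ring
  have hz' : ‖1 / 2 * z‖ ≤ q ^ 2 / 6 := by rw [norm_mul]; norm_num; linarith
  calc _ = ‖∫ a, (Complex.exp (A a) - 1 - A a - A a ^ 2 / 2) ∂μ + w + 1 / 2 * z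
        - (Complex.exp (1 / 2 * v) - 1 - 1 / 2 * v)‖ := by rw [← etot]
    _ ≤ _ := norm_sub_le _ _
    _ ≤ (Real.exp s - 1 - s - s ^ 2 / 2) / 3 + R * q / 3 + q ^ 2 / 6
        + (Real.exp (R ^ 2 / 6) - 1 - R ^ 2 / 6) := by
      refine add_le_add ((norm_add_le _ _).trans (add_le_add ((norm_add_le _ _).trans ?_) hz')) hexp
      exact add_le_add hrem hXY
    _ ≤ _ := remainder_le hR hq

theorem norm_integral_exp_add_sub_exp_le' {x y : α → ℂ} (hxi : Integrable x μ)
    (hyi : Integrable y μ) (hS : ∀ᵐ a ∂μ, a ∈ S)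
    (hx : ∀ a ∈ S, ∀ b ∈ S, ‖x a - x b‖ ≤ R) (hy : ∀ a ∈ S, ∀ b ∈ S, ‖y a - y b‖ ≤ q) :
    ‖∫ a, Complex.exp (x a + 1 / 2 * y a) ∂μ - Complex.exp (∫ a, x a ∂μ + 1 / 2 * ∫ a, y a ∂μ
        + 1 / 2 * ∫ a, (x a - ∫ b, x b ∂μ) ^ 2 ∂μ)‖
      ≤ Real.exp (∫ a, x a ∂μ + 1 / 2 * ∫ a, y a ∂μ).re
        * (Real.exp (errorExponent R (q / 2)) - 1) := by
  set c := ∫ a, x a ∂μ with hc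
  set d := ∫ a, y a ∂μ with hd
  have h := norm_integral_exp_add_sub_exp_le (μ := μ) (S := S) (R := R) (q := q / 2)
    (X := fun a => x a - c) (Y := fun a => 1 / 2 * (y a - d))
    (hxi.sub (integrable_const _)) ((hyi.sub (integrable_const _)).const_mul _)
    (by rw [integral_sub hxi (integrable_const _)]; simp [c])
    (by rw [integral_const_mul, integral_sub hyi (integrable_const _)]; simp [d]) hS
    (by simpa using hx) (fun a ha b hb => by
      have := hy a ha b hb
      calc ‖1 / 2 * (y a - d) - 1 / 2 * (y b - d)‖ = ‖1 / 2 * (y a - y b)‖ := by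
            congr 1; ring
        _ ≤ q / 2 := by rw [norm_mul]; norm_num; linarith)
  have e : ∫ a, Complex.exp (x a + 1 / 2 * y a) ∂μ
      = Complex.exp (c + 1 / 2 * d) * ∫ a, Complex.exp (x a - c + 1 / 2 * (y a - d)) ∂μ := by
    rw [← integral_const_mul]
    refine integral_congr_ae (.of_forall fun a => ?_)
    simp only [← Complex.exp_add]
    congr 1; ring
  rw [e, Complex.exp_add (c + 1 / 2 * d), ← mul_sub, norm_mul, Complex.norm_exp]
  gcongr

/-- One step of the backward recursion, for an unconditional expectation. -/
theorem norm_integral_sub_exp_le {x y g : α → ℂ} {y' : α → ℝ} {Q b C : ℝ}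
    (hxm : Measurable x) (hym : Measurable y) (hym' : Measurable y') (hgm : Measurable g)
    (hxC : ∀ᵐ a ∂μ, ‖x a‖ ≤ C) (hyC : ∀ᵐ a ∂μ, ‖y a‖ ≤ C) (hyC' : ∀ᵐ a ∂μ, |y' a| ≤ C)
    (hgC : ∀ᵐ a ∂μ, ‖g a‖ ≤ C) (hS : ∀ᵐ a ∂μ, a ∈ S)
    (hx : ∀ a ∈ S, ∀ b ∈ S, ‖x a - x b‖ ≤ R) (hy : ∀ a ∈ S, ∀ b ∈ S, ‖y a - y b‖ ≤ Q)
    (hy' : ∀ a ∈ S, ∀ b ∈ S, |y' a - y' b| ≤ Q) (hb : 0 ≤ b)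
    (hyy' : ∀ᵐ a ∂μ, (y a).re ≤ y' a)
    (hg : ∀ᵐ a ∂μ, ‖g a - Complex.exp (x a + 1 / 2 * y a)‖
      ≤ b * Real.exp ((x a).re + 1 / 2 * y' a)) :
    ‖∫ a, g a ∂μ - Complex.exp (∫ a, x a ∂μ + 1 / 2 * ∫ a, y a ∂μ
        + 1 / 2 * ∫ a, (x a - ∫ b, x b ∂μ) ^ 2 ∂μ)‖
      ≤ ((1 + b) * Real.exp (errorExponent R (Q / 2)) - 1)
        * Real.exp ((∫ a, x a ∂μ).re + 1 / 2 * ∫ a, y' a ∂μ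
          + 1 / 2 * ∫ a, ((x a).re - (∫ b, x b ∂μ).re) ^ 2 ∂μ) := by
  have ix : Integrable x μ := Integrable.of_bound hxm.aestronglyMeasurable C hxC
  have iy : Integrable y μ := Integrable.of_bound hym.aestronglyMeasurable C hyC
  have iy' : Integrable y' μ := Integrable.of_bound hym'.aestronglyMeasurable C hyC'
  have ig : Integrable g μ := Integrable.of_bound hgm.aestronglyMeasurable C hgC
  have iexp : Integrable (fun a => Complex.exp (x a + 1 / 2 * y a)) μ := by
    refine Integrable.of_bound (by fun_prop) (Real.exp (C + 1 / 2 * C)) ?_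
    filter_upwards [hxC, hyC] with a h1 h2
    rw [Complex.norm_exp]
    refine Real.exp_le_exp.2 ((Complex.re_le_norm _).trans ((norm_add_le _ _).trans ?_))
    rw [norm_mul]; norm_num; linarith
  have iexp' : Integrable (fun a => Real.exp ((x a).re + 1 / 2 * y' a)) μ := by
    refine Integrable.of_bound (by fun_prop) (Real.exp (C + 1 / 2 * C)) ?_
    filter_upwards [hxC, hyC'] with a h1 h2
    rw [Real.norm_of_nonneg (Real.exp_nonneg _)]
    have := Complex.re_le_norm (x a)
    have := le_abs_self (y' a)
    exact Real.exp_le_exp.2 (by linarith)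
  have hre : ∫ a, (x a).re ∂μ = (∫ a, x a ∂μ).re := integral_re ix
  obtain ⟨a₀, ha₀⟩ := hS.exists
  have hR : 0 ≤ R := (norm_nonneg _).trans (hx a₀ ha₀ a₀ ha₀)
  have hQ : 0 ≤ Q := (norm_nonneg _).trans (hy a₀ ha₀ a₀ ha₀)
  set δ := errorExponent R (Q / 2) with hδ
  have hδ0 : 1 ≤ Real.exp δ := Real.one_le_exp (errorExponent_nonneg hR (by positivity))
  have h1 := norm_integral_exp_add_sub_exp_le' ix iy hS hx hy
  -- The same estimate for the real data Re x and y' bounds the integral by which the inherited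
  -- error `b` is multiplied.
  have h2 := norm_integral_exp_add_sub_exp_le' (R := R) (q := Q)
    (x := fun a => ((x a).re : ℂ)) (y := fun a => (y' a : ℂ)) (S := S) (μ := μ)
    ix.re.ofReal iy'.ofReal hS
    (fun a ha b hb => by
      rw [← Complex.ofReal_sub, Complex.norm_real, ← Complex.sub_re]
      exact (Complex.abs_re_le_norm _).trans (hx a ha b hb))
    (fun a ha b hb => by
      rw [← Complex.ofReal_sub, Complex.norm_real]
      exact hy' a ha b hb)
  set c := ∫ a, x a ∂μ with hc
  set d := ∫ a, y a ∂μ with hd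
  set d' := ∫ a, y' a ∂μ with hd'
  set u := ∫ a, ((x a).re - c.re) ^ 2 ∂μ with hu
  have hu0 : 0 ≤ u := integral_nonneg fun a => sq_nonneg _
  have hdd' : d.re ≤ d' := by
    have e : d.re = ∫ a, (y a).re ∂μ := (integral_re iy).symm
    rw [e]
    exact integral_mono_ae iy.re iy' hyy'
  have e1 : ∫ a, Complex.exp (((x a).re : ℂ) + 1 / 2 * (y' a : ℂ)) ∂μ
      = ((∫ a, Real.exp ((x a).re + 1 / 2 * y' a) ∂μ : ℝ) : ℂ) := by
    rw [← integral_complex_ofReal]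
    congr 1; funext a; push_cast; rfl
  have e2 : ∫ a, ((x a).re : ℂ) ∂μ = (c.re : ℂ) := by
    rw [integral_complex_ofReal, hre]
  have e3 : ∫ a, (y' a : ℂ) ∂μ = (d' : ℂ) := integral_complex_ofReal
  have e4 : ∫ a, (((x a).re : ℂ) - (c.re : ℂ)) ^ 2 ∂μ = (u : ℂ) := by
    rw [hu, ← integral_complex_ofReal]
    congr 1; funext a; push_cast; rfl
  rw [e1, e2, e3, e4] at h2
  have e5 : Complex.exp ((c.re : ℂ) + 1 / 2 * (d' : ℂ) + 1 / 2 * (u : ℂ))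
      = (Real.exp (c.re + 1 / 2 * d' + 1 / 2 * u) : ℂ) := by push_cast; rfl
  have e6 : ((c.re : ℂ) + 1 / 2 * (d' : ℂ)).re = c.re + 1 / 2 * d' := by
    simp
  have e7 : (c + 1 / 2 * d).re = c.re + 1 / 2 * d.re := by
    simp
  rw [e5, ← Complex.ofReal_sub, Complex.norm_real, e6] at h2
  rw [e7] at h1
  set E := Real.exp (c.re + 1 / 2 * d' + 1 / 2 * u) with hE
  -- Both prefactors are absorbed into E: the first since u ≥ 0, the second since moreover Re y ≤ y'
  -- in the mean.
  have hE1 : Real.exp (c.re + 1 / 2 * d') ≤ E := Real.exp_le_exp.2 (by linarith)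
  have hE2 : Real.exp (c.re + 1 / 2 * d.re) ≤ E := Real.exp_le_exp.2 (by linarith)
  set I := ∫ a, Real.exp ((x a).re + 1 / 2 * y' a) ∂μ with hI
  have hI' : I ≤ Real.exp δ * E := by
    have := (le_abs_self _).trans h2
    nlinarith
  have h3 : ‖∫ a, g a ∂μ - ∫ a, Complex.exp (x a + 1 / 2 * y a) ∂μ‖ ≤ b * I := by
    rw [← integral_sub ig iexp, hI, ← integral_const_mul]
    exact norm_integral_le_of_norm_le (iexp'.const_mul _) hg
  calc _ ≤ _ := norm_sub_le_norm_sub_add_norm_sub _ (∫ a, Complex.exp (x a + 1 / 2 * y a) ∂μ) _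
    _ ≤ b * (Real.exp δ * E) + E * (Real.exp δ - 1) := by
      refine add_le_add (h3.trans (by gcongr)) (h1.trans ?_)
      exact mul_le_mul_of_nonneg_right hE2 (by linarith)
    _ = _ := by ring

end CentredVariables

/-! ### Regular conditional laws. -/

section ConditionalLaw

/-- A regular conditional law `κ` of `W` given the sub-σ-field `m`. -/
structure IsCondLaw {Ω E : Type*} {m₀ : MeasurableSpace Ω} [MeasurableSpace E]
    (m : MeasurableSpace Ω) (P : Measure[m₀] Ω) (W : Ω → E) (κ : Ω → Measure E) : Prop where
  isProbabilityMeasure : ∀ ω, IsProbabilityMeasure (κ ω)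
  condExp_ae_eq {𝕜 : Type} [NormedAddCommGroup 𝕜] [NormedSpace ℝ 𝕜] [CompleteSpace 𝕜]
    (f : Ω × E → 𝕜) : StronglyMeasurable[m.prod inferInstance] f →
      Integrable (fun ω => f (ω, W ω)) P →
      P[fun ω => f (ω, W ω) | m] =ᵐ[P] fun ω => ∫ e, f (ω, e) ∂κ ω
  ae_iff (p : Ω × E → Prop) : MeasurableSet[m.prod inferInstance] {x | p x} →
    ((∀ᵐ ω ∂P, p (ω, W ω)) ↔ ∀ᵐ ω ∂P, ∀ᵐ e ∂κ ω, p (ω, e))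

variable {Ω E : Type*} {m₀ : MeasurableSpace Ω} {P : Measure[m₀] Ω}

theorem ae_iff_ae_ae_condDistrib [IsProbabilityMeasure P] [MeasurableSpace E]
    [StandardBorelSpace E] [Nonempty E]   {β : Type*} {mβ : MeasurableSpace β} {X : Ω → β} (hX : Measurable X)
    {W : Ω → E} (hW : Measurable W) (p : β × E → Prop) (hp : MeasurableSet {x | p x}) :
    (∀ᵐ ω ∂P, p (X ω, W ω)) ↔ ∀ᵐ ω ∂P, ∀ᵐ e ∂condDistrib W X P (X ω), p (X ω, e) := by
  rw [← ae_map_iff (f := fun ω => (X ω, W ω)) (hX.prodMk hW).aemeasurable hp,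
    ← compProd_map_condDistrib hW.aemeasurable, Measure.ae_compProd_iff hp,
    ae_map_iff hX.aemeasurable]
  exact Kernel.measurable_kernel_prodMk_left hp.compl (measurableSet_singleton 0)

/-- Conditioning on m is conditioning on the identity map from Ω with `m₀` to Ω with `m`. Since f
and p may also depend on ω through m, measurable parameters can be frozen under the law. -/
theorem exists_isCondLaw [IsProbabilityMeasure P] {m : MeasurableSpace Ω} (hm : m ≤ m₀)
    [MeasurableSpace E] [StandardBorelSpace E] [Nonempty E] {W : Ω → E}
    (hW : Measurable[m₀] W) : ∃ κ, IsCondLaw m P W κ := by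
  have hid : @Measurable Ω Ω m₀ m id := measurable_id'' hm
  refine ⟨fun ω => @condDistrib Ω Ω E _ _ _ m₀ m W id P _ ω, ?_, ?_, ?_⟩
  · intro ω
    infer_instance
  · intro 𝕜 _ _ _ f hf hfi
    have h := @condExp_prod_ae_eq_integral_condDistrib Ω Ω E 𝕜 _ _ _ _ m₀ P _ id W m f _ _ hid
      hW.aemeasurable hf hfi
    rwa [MeasurableSpace.comap_id] at h
  · intro p hp
    exact ae_iff_ae_ae_condDistrib hid hW p hp

end ConditionalLaw

/-! ### Power means and the essential supremum. -/

section EssentialSupremum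

/-- On a probability space the L^r norms tend to the L^∞ norm l: they are at most l, and for b < l
they are at least b p^{1/r}, where p > 0 is the mass of {f ≥ b}. -/
theorem exists_tendsto_integral_pow_rpow {α : Type*} {mα : MeasurableSpace α} {ν : Measure α}
    [IsProbabilityMeasure ν] {f : α → ℝ} (hf : Measurable f) {D : ℝ}
    (hf0 : ∀ᵐ a ∂ν, 0 ≤ f a) (hfD : ∀ᵐ a ∂ν, f a ≤ D) :
    ∃ l ≤ D, (∀ᵐ a ∂ν, f a ≤ l) ∧
      Tendsto (fun r : ℕ => (∫ a, f a ^ r ∂ν) ^ (1 / (r : ℝ))) atTop (𝓝 l) := by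
  obtain ⟨a₁, h0, h1⟩ := (hf0.and hfD).exists
  have hD0 : 0 ≤ D := h0.trans h1
  have hbd : ∀ᵐ a ∂ν, ‖f a‖ ≤ D := by
    filter_upwards [hf0, hfD] with a h0 h1
    rwa [Real.norm_of_nonneg h0]
  have htop : eLpNorm f ∞ ν ≤ ENNReal.ofReal D := by
    rw [eLpNorm_exponent_top]
    exact eLpNormEssSup_le_of_ae_bound hbd
  have hne : eLpNorm f ∞ ν ≠ ∞ := (htop.trans_lt ENNReal.ofReal_lt_top).ne
  set l := (eLpNorm f ∞ ν).toReal with hl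
  have hl0 : 0 ≤ l := ENNReal.toReal_nonneg
  have hlD : l ≤ D := by
    rw [hl, ← ENNReal.toReal_ofReal hD0]
    exact ENNReal.toReal_mono ENNReal.ofReal_ne_top htop
  have hfl : ∀ᵐ a ∂ν, f a ≤ l := by
    have h := enorm_ae_le_eLpNormEssSup f ν
    filter_upwards [h] with a ha
    rw [← eLpNorm_exponent_top] at ha
    have := ENNReal.toReal_mono hne ha
    rw [toReal_enorm] at this
    exact (le_abs_self _).trans this
  have hint : ∀ r : ℕ, Integrable (fun a => f a ^ r) ν := fun r => by
    refine Integrable.of_bound (by fun_prop) (D ^ r) ?_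
    filter_upwards [hbd] with a ha
    rw [norm_pow]
    exact pow_le_pow_left₀ (norm_nonneg _) ha r
  have hI0 : ∀ r : ℕ, 0 ≤ ∫ a, f a ^ r ∂ν := fun r => integral_nonneg_of_ae (by
    filter_upwards [hf0] with a ha using pow_nonneg ha r)
  refine ⟨l, hlD, hfl, tendsto_order.2 ⟨fun a ha => ?_, fun a ha => ?_⟩⟩
  · rcases lt_or_ge a 0 with h | h
    · exact .of_forall fun r => h.trans_le (Real.rpow_nonneg (hI0 r) _)
    · obtain ⟨b, hab, hbl⟩ := exists_between ha
      have hb0 : 0 < b := h.trans_lt hab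
      set p := ν.real {x | b ≤ f x} with hp
      have hp0 : 0 < p := by
        refine ENNReal.toReal_pos (fun hz => ?_) (measure_ne_top _ _)
        have : ∀ᵐ x ∂ν, ‖f x‖ ≤ b := by
          have hz' : ∀ᵐ x ∂ν, ¬ b ≤ f x := by rw [ae_iff]; simpa using hz
          filter_upwards [hz', hf0] with x hx hx0
          rw [Real.norm_of_nonneg hx0]
          exact (not_le.1 hx).le
        have h2 := eLpNormEssSup_le_of_ae_bound this
        rw [← eLpNorm_exponent_top] at h2
        have h3 := ENNReal.toReal_mono ENNReal.ofReal_ne_top h2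
        rw [ENNReal.toReal_ofReal hb0.le] at h3
        linarith
      have hlim : Tendsto (fun r : ℕ => b * p ^ (1 / (r : ℝ))) atTop (𝓝 (b * p ^ (0 : ℝ))) := by
        refine Tendsto.const_mul b ?_
        exact (Real.continuousAt_const_rpow hp0.ne').tendsto.comp
          tendsto_one_div_atTop_nhds_zero_nat
      rw [Real.rpow_zero, mul_one] at hlim
      filter_upwards [hlim.eventually (lt_mem_nhds hab), eventually_ge_atTop 1] with r hr hr1
      refine hr.trans_le ?_
      have hr0 : r ≠ 0 := by omega
      have h4 : b ^ r * p ≤ ∫ a, f a ^ r ∂ν := by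
        have hset : MeasurableSet {x | b ≤ f x} := measurableSet_le measurable_const hf
        calc b ^ r * p = ∫ x, {x | b ≤ f x}.indicator (fun _ => b ^ r) x ∂ν := by
              rw [integral_indicator_const _ hset, smul_eq_mul, mul_comm]
          _ ≤ _ := by
            refine integral_mono_ae ((integrable_const _).indicator hset) (hint r) ?_
            filter_upwards [hf0] with x hx
            by_cases hxb : x ∈ {x | b ≤ f x}
            · rw [Set.indicator_of_mem hxb]
              exact pow_le_pow_left₀ hb0.le hxb r
            · rw [Set.indicator_of_notMem hxb]
              exact pow_nonneg hx r
      calc b * p ^ (1 / (r : ℝ)) = (b ^ r * p) ^ (1 / (r : ℝ)) := by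
            rw [Real.mul_rpow (by positivity) hp0.le, one_div, Real.pow_rpow_inv_natCast hb0.le hr0]
        _ ≤ _ := Real.rpow_le_rpow (by positivity) h4 (by positivity)
  · filter_upwards [eventually_ge_atTop 1] with r hr1
    have hr0 : r ≠ 0 := by omega
    refine lt_of_le_of_lt ?_ ha
    have h4 : ∫ a, f a ^ r ∂ν ≤ l ^ r := by
      have := integral_mono_ae (hint r) (integrable_const (l ^ r)) (by
        filter_upwards [hf0, hfl] with x hx hxl using pow_le_pow_left₀ hx hxl r)
      simpa using this
    calc _ ≤ (l ^ r) ^ (1 / (r : ℝ)) := Real.rpow_le_rpow (hI0 r) h4 (by positivity)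
      _ = l := by rw [one_div, Real.pow_rpow_inv_natCast hl0 hr0]

end EssentialSupremum

/-! ### Conditional essential suprema and diameters, and the conditional one-step estimate. -/

namespace ComplexMartingale

variable {Ω : Type*} {m₀ : MeasurableSpace Ω} {P : Measure[m₀] Ω} {m : MeasurableSpace Ω}

theorem measurable_condEssSup (X : Ω → ℝ) : Measurable[m] (condEssSup m P X) := by
  unfold condEssSup
  refine Measurable.sub_const (StronglyMeasurable.measurable ?_) _
  refine StronglyMeasurable.limUnder fun r => Measurable.stronglyMeasurable ?_
  exact stronglyMeasurable_condExp.measurable.pow_const _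

theorem measurable_condDiam (Z : Ω → ℂ) : Measurable[m] (condDiam m P Z) :=
  Measurable.iSup fun _ => (measurable_condEssSup _).add (measurable_condEssSup _)

/-- For almost every ω all the conditional moments, countably many, are moments of the law `κ ω`, so
the limit of power means dominates almost every point under `κ ω`. This transfers back to X because
the limit is m-measurable. -/
theorem ae_le_condEssSup [IsProbabilityMeasure P] (hm : m ≤ m₀) {X : Ω → ℝ}
    (hX : AEStronglyMeasurable[m₀] X P) {C : ℝ} (hC : ∀ᵐ ω ∂P, |X ω| ≤ C) :
    (∀ᵐ ω ∂P, X ω ≤ condEssSup m P X ω) ∧ ∀ᵐ ω ∂P, condEssSup m P X ω ≤ C := by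
  obtain ⟨κ, hκ⟩ := exists_isCondLaw (P := P) hm hX.stronglyMeasurable_mk.measurable
  have := hκ.isProbabilityMeasure
  obtain ⟨ω₀, hω₀⟩ := hC.exists
  have hC0 : 0 ≤ C := (abs_nonneg _).trans hω₀
  have htop : eLpNorm X ∞ P ≤ ENNReal.ofReal C := by
    rw [eLpNorm_exponent_top]
    exact eLpNormEssSup_le_of_ae_bound hC
  have hne : eLpNorm X ∞ P ≠ ∞ := (htop.trans_lt ENNReal.ofReal_lt_top).ne
  set c := (eLpNorm X ∞ P).toReal with hc
  have hcC : c ≤ C := by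
    rw [hc, ← ENNReal.toReal_ofReal hC0]
    exact ENNReal.toReal_mono ENNReal.ofReal_ne_top htop
  have hXc : ∀ᵐ ω ∂P, |hX.mk X ω| ≤ c := by
    filter_upwards [enorm_ae_le_eLpNormEssSup X P, hX.ae_eq_mk] with ω h e
    rw [← eLpNorm_exponent_top] at h
    have := ENNReal.toReal_mono hne h
    rw [toReal_enorm] at this
    rwa [← e]
  have hexp : ∀ᵐ ω ∂P, ∀ r : ℕ, (P[fun ω' => (X ω' + c) ^ r | m]) ω
      = ∫ e, (e + c) ^ r ∂κ ω := by
    refine ae_all_iff.2 fun r => ?_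
    have h1 : P[fun ω' => (X ω' + c) ^ r | m] =ᵐ[P] P[fun ω' => (hX.mk X ω' + c) ^ r | m] :=
      condExp_congr_ae (by filter_upwards [hX.ae_eq_mk] with ω e; rw [e])
    have h2 := hκ.condExp_ae_eq (fun x => (x.2 + c) ^ r)
      (by
        have : @Measurable (Ω × ℝ) ℝ (m.prod inferInstance) _ fun x => x.2 := measurable_snd
        exact ((this.add_const c).pow_const r).stronglyMeasurable)
      (by
        refine Integrable.of_bound
          ((hX.stronglyMeasurable_mk.add stronglyMeasurable_const).pow r).aestronglyMeasurable
          ((2 * c) ^ r) ?_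
        filter_upwards [hXc] with ω h
        rw [norm_pow]
        refine pow_le_pow_left₀ (norm_nonneg _) ?_ r
        rw [Real.norm_eq_abs, abs_le]
        constructor <;> linarith [abs_le.1 h])
    exact h1.trans h2
  have hκc : ∀ᵐ ω ∂P, ∀ᵐ e ∂κ ω, |e| ≤ c :=
    (hκ.ae_iff (fun x => |x.2| ≤ c) (by
      have : @Measurable (Ω × ℝ) ℝ (m.prod inferInstance) _ fun x => x.2 := measurable_snd
      exact measurableSet_le this.abs measurable_const)).1 hXc
  have key : ∀ᵐ ω ∂P, (∀ᵐ e ∂κ ω, e ≤ condEssSup m P X ω) ∧ condEssSup m P X ω ≤ C := by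
    filter_upwards [hexp, hκc] with ω h1 h2
    obtain ⟨l, hl, hle, hlim⟩ := exists_tendsto_integral_pow_rpow (ν := κ ω)
      (f := fun e => e + c) (D := 2 * c) (by fun_prop)
      (by filter_upwards [h2] with e he; linarith [abs_le.1 he])
      (by filter_upwards [h2] with e he; linarith [abs_le.1 he])
    have e : condEssSup m P X ω = l - c := by
      simp only [condEssSup, ← hc, h1]
      rw [hlim.limUnder_eq]
    rw [e]
    refine ⟨?_, by linarith⟩
    filter_upwards [hle] with e he
    linarith
  refine ⟨?_, key.mono fun _ h => h.2⟩
  have h3 := (hκ.ae_iff (fun x => x.2 ≤ condEssSup m P X x.1) (by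
    have h1 : @Measurable (Ω × ℝ) ℝ (m.prod inferInstance) _ fun x => x.2 := measurable_snd
    have h2 : @Measurable (Ω × ℝ) ℝ (m.prod inferInstance) _ fun x => condEssSup m P X x.1 :=
      (measurable_condEssSup X).comp measurable_fst
    exact measurableSet_le h1 h2)).2 (key.mono fun _ h => h.1)
  filter_upwards [h3, hX.ae_eq_mk] with ω h e
  rwa [e]

theorem exp_neg_I_mul_arg_mul (z : ℂ) :
    Complex.exp (-(Complex.I * (z.arg : ℂ))) * z = (‖z‖ : ℂ) := by
  nth_rewrite 2 [← Complex.norm_mul_exp_arg_mul_I z]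
  rw [mul_left_comm, ← Complex.exp_add]
  ring_nf
  simp

/-- Rotating z by its argument makes it equal to its norm. The rational angles are dense in [-π, π],
endpoints included, and the bound is closed in the angle. -/
theorem norm_le_of_forall_angle {z : ℂ} {d : ℝ}
    (h : ∀ θ : {q : ℚ // (q : ℝ) ∈ Set.Ioc (-Real.pi) Real.pi},
      (Complex.exp (-(Complex.I * ((θ : ℚ) : ℂ))) * z).re ≤ d) : ‖z‖ ≤ d := by
  have hcont : Continuous fun t : ℝ => (Complex.exp (-(Complex.I * (t : ℂ))) * z).re := by
    fun_prop
  have hclosed : IsClosed {t : ℝ | (Complex.exp (-(Complex.I * (t : ℂ))) * z).re ≤ d} :=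
    isClosed_le hcont continuous_const
  have hmem : z.arg ∈ closure (Set.Ioo (-Real.pi) Real.pi ∩ Set.range ((↑) : ℚ → ℝ)) := by
    have h1 := (Rat.denseRange_cast (𝕜 := ℝ)).open_subset_closure_inter
      (isOpen_Ioo (a := -Real.pi) (b := Real.pi))
    have h2 : Set.Icc (-Real.pi) Real.pi
        ⊆ closure (Set.Ioo (-Real.pi) Real.pi ∩ Set.range ((↑) : ℚ → ℝ)) := by
      rw [← closure_Ioo (by linarith [Real.pi_pos])]
      exact closure_minimal h1 isClosed_closure
    exact h2 ⟨(Complex.neg_pi_lt_arg z).le, Complex.arg_le_pi z⟩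
  have hsub : Set.Ioo (-Real.pi) Real.pi ∩ Set.range ((↑) : ℚ → ℝ)
      ⊆ {t : ℝ | (Complex.exp (-(Complex.I * (t : ℂ))) * z).re ≤ d} := by
    rintro _ ⟨ht, q, rfl⟩
    have := h ⟨q, Set.Ioo_subset_Ioc_self ht⟩
    simpa using this
  have : (Complex.exp (-(Complex.I * (z.arg : ℂ))) * z).re ≤ d :=
    closure_minimal hsub hclosed hmem
  rw [exp_neg_I_mul_arg_mul] at this
  simpa using this

theorem abs_re_exp_mul_le (t : ℚ) (z : ℂ) :
    |(Complex.exp (-(Complex.I * (t : ℂ))) * z).re| ≤ ‖z‖ := by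
  refine (Complex.abs_re_le_norm _).trans ?_
  rw [norm_mul, show -(Complex.I * (t : ℂ)) = ((-(t : ℝ) : ℝ) : ℂ) * Complex.I by
    push_cast; ring, Complex.norm_exp_ofReal_mul_I, one_mul]

/-- The values of `W` under its conditional law have mutual distances at most the
conditional diameter. -/
theorem ae_exists_norm_sub_le_condDiam [IsProbabilityMeasure P] (hm : m ≤ m₀)
    {E : Type*} [MeasurableSpace E] {V : Ω → E} (hV : Measurable[m₀] V) {κ : Ω → Measure E}
    (hκ : IsCondLaw m P V κ) {g : E → ℂ} (hg : Measurable g) {C : ℝ}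
    (hC : ∀ᵐ ω ∂P, ‖g (V ω)‖ ≤ C) :
    ∀ᵐ ω ∂P, (∃ S : Set E, (∀ᵐ e ∂κ ω, e ∈ S) ∧ ∀ e ∈ S, ∀ e' ∈ S,
      ‖g e - g e'‖ ≤ condDiam m P (fun ω' => g (V ω')) ω)
      ∧ condDiam m P (fun ω' => g (V ω')) ω ≤ 2 * C := by
  let Θ := {q : ℚ // (q : ℝ) ∈ Set.Ioc (-Real.pi) Real.pi}
  let ρ : Θ → E → ℝ := fun θ e => (Complex.exp (-(Complex.I * ((θ : ℚ) : ℂ))) * g e).re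
  have hρ : ∀ θ, Measurable (ρ θ) := fun θ => by
    exact Complex.measurable_re.comp (hg.const_mul _)
  have hρV : ∀ θ, Measurable[m₀] fun ω => ρ θ (V ω) := fun θ => (hρ θ).comp hV
  have hρC : ∀ θ, ∀ᵐ ω ∂P, |ρ θ (V ω)| ≤ C := fun θ => by
    filter_upwards [hC] with ω h using (abs_re_exp_mul_le _ _).trans h
  have hρC' : ∀ θ, ∀ᵐ ω ∂P, |-ρ θ (V ω)| ≤ C := fun θ => by simpa using hρC θ
  let U : Θ → Ω → ℝ := fun θ => condEssSup m P fun ω => ρ θ (V ω)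
  let U' : Θ → Ω → ℝ := fun θ => condEssSup m P fun ω => -ρ θ (V ω)
  have h1 : ∀ θ, (∀ᵐ ω ∂P, ρ θ (V ω) ≤ U θ ω) ∧ ∀ᵐ ω ∂P, U θ ω ≤ C := fun θ =>
    ae_le_condEssSup hm (hρV θ).aestronglyMeasurable (hρC θ)
  have h2 : ∀ θ, (∀ᵐ ω ∂P, -ρ θ (V ω) ≤ U' θ ω) ∧ ∀ᵐ ω ∂P, U' θ ω ≤ C := fun θ =>
    ae_le_condEssSup hm (hρV θ).neg.aestronglyMeasurable (hρC' θ)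
  have hmeas : ∀ {f : E → ℝ} {u : Ω → ℝ}, Measurable f → Measurable[m] u →
      MeasurableSet[m.prod inferInstance] {x : Ω × E | f x.2 ≤ u x.1} := fun {f u} hf hu => by
    have a : @Measurable (Ω × E) ℝ (m.prod inferInstance) _ fun x => f x.2 :=
      hf.comp measurable_snd
    have b : @Measurable (Ω × E) ℝ (m.prod inferInstance) _ fun x => u x.1 :=
      hu.comp measurable_fst
    exact measurableSet_le a b
  have k1 : ∀ᵐ ω ∂P, ∀ θ, ∀ᵐ e ∂κ ω, ρ θ e ≤ U θ ω := ae_all_iff.2 fun θ =>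
    (hκ.ae_iff (fun x => ρ θ x.2 ≤ U θ x.1) (hmeas (hρ θ) (measurable_condEssSup _))).1 (h1 θ).1
  have k2 : ∀ᵐ ω ∂P, ∀ θ, ∀ᵐ e ∂κ ω, -ρ θ e ≤ U' θ ω := ae_all_iff.2 fun θ =>
    (hκ.ae_iff (fun x => -ρ θ x.2 ≤ U' θ x.1)
      (hmeas (hρ θ).neg (measurable_condEssSup _))).1 (h2 θ).1
  filter_upwards [k1, k2, ae_all_iff.2 fun θ => (h1 θ).2, ae_all_iff.2 fun θ => (h2 θ).2]
    with ω a1 a2 b1 b2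
  have hD : condDiam m P (fun ω' => g (V ω')) ω = ⨆ θ, (U θ ω + U' θ ω) := rfl
  have : Nonempty Θ := ⟨⟨0, by simp [Real.pi_pos, Real.pi_pos.le]⟩⟩
  have hle : ∀ θ, U θ ω + U' θ ω ≤ 2 * C := fun θ => by linarith [b1 θ, b2 θ]
  -- Needed for `le_ciSup`: a real supremum over an unbounded family would take a default value.
  have hbdd : BddAbove (Set.range fun θ => U θ ω + U' θ ω) :=
    ⟨2 * C, by rintro _ ⟨θ, rfl⟩; exact hle θ⟩
  -- S is the intersection of the countably many supporting strips, hence of full measure; a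
  -- difference of two of its points has each rotated real part at most the width of the strip.
  refine ⟨⟨{e | ∀ θ, ρ θ e ≤ U θ ω ∧ -ρ θ e ≤ U' θ ω}, ?_, ?_⟩, ?_⟩
  · filter_upwards [ae_all_iff.2 a1, ae_all_iff.2 a2] with e h3 h4 using fun θ => ⟨h3 θ, h4 θ⟩
  · intro e he e' he'
    refine norm_le_of_forall_angle fun θ => ?_
    rw [hD, mul_sub, Complex.sub_re]
    have h3 := (he θ).1
    have h4 := (he' θ).2
    have h5 := le_ciSup hbdd θ
    simp only [ρ] at h3 h4
    linarith
  · rw [hD]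
    exact ciSup_le hle

theorem ae_condDiam_mem_Icc [IsProbabilityMeasure P] (hm : m ≤ m₀) {Z : Ω → ℂ}
    (hZ : Measurable[m₀] Z) {C : ℝ} (hC : ∀ᵐ ω ∂P, ‖Z ω‖ ≤ C) :
    ∀ᵐ ω ∂P, 0 ≤ condDiam m P Z ω ∧ condDiam m P Z ω ≤ 2 * C := by
  obtain ⟨κ, hκ⟩ := exists_isCondLaw (P := P) hm hZ
  have := hκ.isProbabilityMeasure
  filter_upwards [ae_exists_norm_sub_le_condDiam hm hZ hκ measurable_id hC] with ω h
  obtain ⟨⟨S, hS, hd⟩, h2⟩ := h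
  obtain ⟨e, he⟩ := hS.exists
  exact ⟨(norm_nonneg _).trans (hd e he e he), h2⟩

/-- One step of the backward recursion. -/
theorem ae_norm_condExp_sub_exp_le [IsProbabilityMeasure P] (hm : m ≤ m₀)
    {x y g : Ω → ℂ} {y' b : Ω → ℝ} {C : ℝ}
    (hx : Measurable[m₀] x) (hy : Measurable[m₀] y) (hg : Measurable[m₀] g)
    (hy' : Measurable[m₀] y') (hb : Measurable[m] b)
    (hxC : ∀ᵐ ω ∂P, ‖x ω‖ ≤ C) (hyC : ∀ᵐ ω ∂P, ‖y ω‖ ≤ C) (hgC : ∀ᵐ ω ∂P, ‖g ω‖ ≤ C)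
    (hyC' : ∀ᵐ ω ∂P, |y' ω| ≤ C) (hb0 : ∀ᵐ ω ∂P, 0 ≤ b ω) (hyy' : ∀ᵐ ω ∂P, (y ω).re ≤ y' ω)
    (h : ∀ᵐ ω ∂P, ‖g ω - Complex.exp (x ω + 1 / 2 * y ω)‖
      ≤ b ω * Real.exp ((x ω).re + 1 / 2 * y' ω)) :
    ∀ᵐ ω ∂P, ‖(P[g | m]) ω - Complex.exp ((P[x | m]) ω + 1 / 2 * (P[y | m]) ω
        + 1 / 2 * (P[fun ω' => (x ω' - (P[x | m]) ω') ^ 2 | m]) ω)‖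
      ≤ ((1 + b ω) * Real.exp (errorExponent (condDiam m P x ω)
            (max (condDiam m P y ω) (condDiam m P (fun ω' => (y' ω' : ℂ)) ω) / 2)) - 1)
        * Real.exp (((P[x | m]) ω).re + 1 / 2 * (P[y' | m]) ω
          + 1 / 2 * (P[fun ω' => ((x ω').re - ((P[x | m]) ω').re) ^ 2 | m]) ω) := by
  -- A single conditional law of the joint vector serves all conditional expectations at once; b and
  -- the conditional mean of x enter as frozen parameters.
  let V : Ω → ℂ × ℂ × ℂ × ℝ := fun ω => (x ω, y ω, g ω, y' ω)
  have hV : Measurable[m₀] V := hx.prodMk (hy.prodMk (hg.prodMk hy'))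
  obtain ⟨κ, hκ⟩ := exists_isCondLaw (P := P) hm hV
  have := hκ.isProbabilityMeasure
  have hsnd : @Measurable (Ω × (ℂ × ℂ × ℂ × ℝ)) _ (m.prod inferInstance) _ fun p => p.2 :=
    measurable_snd
  have hfst : @Measurable (Ω × (ℂ × ℂ × ℂ × ℝ)) _ (m.prod inferInstance) m fun p => p.1 :=
    measurable_fst
  have m1 : Measurable fun e : ℂ × ℂ × ℂ × ℝ => e.1 := by fun_prop
  have m2 : Measurable fun e : ℂ × ℂ × ℂ × ℝ => e.2.1 := by fun_prop
  have m3 : Measurable fun e : ℂ × ℂ × ℂ × ℝ => e.2.2.1 := by fun_prop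
  have m4 : Measurable fun e : ℂ × ℂ × ℂ × ℝ => e.2.2.2 := by fun_prop
  have m4c : Measurable fun e : ℂ × ℂ × ℂ × ℝ => (e.2.2.2 : ℂ) := by fun_prop
  have hc : Measurable[m] (P[x | m]) := stronglyMeasurable_condExp.measurable
  have hcC : ∀ᵐ ω ∂P, ‖(P[x | m]) ω‖ ≤ C := ae_bdd_norm_condExp_of_ae_bdd_norm hxC
  have E1 := hκ.condExp_ae_eq (fun p => p.2.1) (m1.comp hsnd).stronglyMeasurable
    (Integrable.of_bound hx.aestronglyMeasurable C hxC)
  have E2 := hκ.condExp_ae_eq (fun p => p.2.2.1) (m2.comp hsnd).stronglyMeasurable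
    (Integrable.of_bound hy.aestronglyMeasurable C hyC)
  have E3 := hκ.condExp_ae_eq (fun p => p.2.2.2.1) (m3.comp hsnd).stronglyMeasurable
    (Integrable.of_bound hg.aestronglyMeasurable C hgC)
  have E4 := hκ.condExp_ae_eq (fun p => p.2.2.2.2) (m4.comp hsnd).stronglyMeasurable
    (Integrable.of_bound hy'.aestronglyMeasurable C hyC')
  have E5 := hκ.condExp_ae_eq (fun p => (p.2.1 - (P[x | m]) p.1) ^ 2)
    (((m1.comp hsnd).sub (hc.comp hfst)).pow_const 2).stronglyMeasurable
    (by
      refine Integrable.of_bound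
        ((hx.sub (hc.mono hm le_rfl)).pow_const 2).aestronglyMeasurable ((C + C) ^ 2) ?_
      filter_upwards [hxC, hcC] with ω h1 h2
      rw [norm_pow]
      exact pow_le_pow_left₀ (norm_nonneg _) ((norm_sub_le _ _).trans (add_le_add h1 h2)) 2)
  have E6 := hκ.condExp_ae_eq (fun p => ((p.2.1).re - ((P[x | m]) p.1).re) ^ 2)
    (((Complex.measurable_re.comp (m1.comp hsnd)).sub
      (Complex.measurable_re.comp (hc.comp hfst))).pow_const 2).stronglyMeasurable
    (by
      refine Integrable.of_bound
        (((Complex.measurable_re.comp hx).sub (Complex.measurable_re.comp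
          (hc.mono hm le_rfl))).pow_const 2).aestronglyMeasurable ((C + C) ^ 2) ?_
      filter_upwards [hxC, hcC] with ω h1 h2
      rw [norm_pow, Real.norm_eq_abs, ← Complex.sub_re]
      exact pow_le_pow_left₀ (abs_nonneg _) ((Complex.abs_re_le_norm _).trans
        ((norm_sub_le _ _).trans (add_le_add h1 h2))) 2)
  have B1 := (hκ.ae_iff (fun p => ‖p.2.1‖ ≤ C)
    (measurableSet_le (m1.comp hsnd).norm measurable_const)).1 hxC
  have B2 := (hκ.ae_iff (fun p => ‖p.2.2.1‖ ≤ C)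
    (measurableSet_le (m2.comp hsnd).norm measurable_const)).1 hyC
  have B3 := (hκ.ae_iff (fun p => ‖p.2.2.2.1‖ ≤ C)
    (measurableSet_le (m3.comp hsnd).norm measurable_const)).1 hgC
  have B4 := (hκ.ae_iff (fun p => |p.2.2.2.2| ≤ C)
    (measurableSet_le (m4.comp hsnd).abs measurable_const)).1 hyC'
  have B5 := (hκ.ae_iff (fun p => (p.2.2.1).re ≤ p.2.2.2.2)
    (measurableSet_le (Complex.measurable_re.comp (m2.comp hsnd)) (m4.comp hsnd))).1 hyy'
  have B6 := (hκ.ae_iff (fun p => ‖p.2.2.2.1 - Complex.exp (p.2.1 + 1 / 2 * p.2.2.1)‖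
      ≤ b p.1 * Real.exp ((p.2.1).re + 1 / 2 * p.2.2.2.2))
    (measurableSet_le
      ((m3.comp hsnd).sub (Complex.measurable_exp.comp
        ((m1.comp hsnd).add ((m2.comp hsnd).const_mul _)))).norm
      ((hb.comp hfst).mul (Real.measurable_exp.comp
        ((Complex.measurable_re.comp (m1.comp hsnd)).add ((m4.comp hsnd).const_mul _)))))).1 h
  have D1 := ae_exists_norm_sub_le_condDiam hm hV hκ m1 hxC
  have D2 := ae_exists_norm_sub_le_condDiam hm hV hκ m2 hyC
  have D3 := ae_exists_norm_sub_le_condDiam hm hV hκ m4c (C := C) (by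
    filter_upwards [hyC'] with ω h1
    rwa [Complex.norm_real])
  filter_upwards [E1, E2, E3, E4, E5, E6, B1, B2, B3, B4, B5, B6, D1, D2, D3, hb0]
    with ω e1 e2 e3 e4 e5 e6 b1 b2 b3 b4 b5 b6 d1 d2 d3 hb0
  obtain ⟨⟨S₁, s1, d1⟩, -⟩ := d1
  obtain ⟨⟨S₂, s2, d2⟩, -⟩ := d2
  obtain ⟨⟨S₃, s3, d3⟩, -⟩ := d3
  have key := norm_integral_sub_exp_le (μ := κ ω) (S := S₁ ∩ S₂ ∩ S₃)
    (R := condDiam m P x ω)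
    (Q := max (condDiam m P y ω) (condDiam m P (fun ω' => (y' ω' : ℂ)) ω)) (b := b ω)
    m1 m2 m4 m3 b1 b2 b4 b3
    (by filter_upwards [s1, s2, s3] with e h1 h2 h3 using ⟨⟨h1, h2⟩, h3⟩)
    (fun e he e' he' => d1 e he.1.1 e' he'.1.1)
    (fun e he e' he' => (d2 e he.1.2 e' he'.1.2).trans (le_max_left _ _))
    (fun e he e' he' => by
      have := (d3 e he.2 e' he'.2).trans (le_max_right (condDiam m P y ω) _)
      rwa [← Complex.ofReal_sub, Complex.norm_real] at this)
    hb0 b5 b6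
  rw [← e1, ← e2, ← e3, ← e4, ← e5, ← e6] at key
  exact key

/-- The decomposition of a conditional second moment along two nested sub-σ-fields. -/
theorem condExp_sq_sub_ae_eq [IsProbabilityMeasure P] {𝕜 : Type*} [RCLike 𝕜]
    {m' : MeasurableSpace Ω} (hmm' : m ≤ m') (hm' : m' ≤ m₀) {U A B : Ω → 𝕜} {C : ℝ}
    (hU : StronglyMeasurable[m₀] U) (hA : StronglyMeasurable[m'] A) (hB : StronglyMeasurable[m] B)
    (hUC : ∀ᵐ ω ∂P, ‖U ω‖ ≤ C) (hAC : ∀ᵐ ω ∂P, ‖A ω‖ ≤ C) (hBC : ∀ᵐ ω ∂P, ‖B ω‖ ≤ C)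
    (hUA : P[U | m'] =ᵐ[P] A) :
    P[fun ω => (U ω - B ω) ^ 2 | m] =ᵐ[P] fun ω =>
      (P[P[fun ω => (U ω - A ω) ^ 2 | m'] | m]) ω + (P[fun ω => (A ω - B ω) ^ 2 | m]) ω := by
  have hA₀ : StronglyMeasurable[m₀] A := hA.mono hm'
  have hB₀ : StronglyMeasurable[m₀] B := hB.mono (hmm'.trans hm')
  have hB' : StronglyMeasurable[m'] B := hB.mono hmm'
  have hUi : Integrable U P := Integrable.of_bound hU.aestronglyMeasurable C hUC
  have hAi : Integrable A P := Integrable.of_bound hA₀.aestronglyMeasurable C hAC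
  have i1 : Integrable (fun ω => (U ω - A ω) ^ 2) P := by
    refine Integrable.of_bound ((hU.sub hA₀).pow 2).aestronglyMeasurable ((C + C) ^ 2) ?_
    filter_upwards [hUC, hAC] with ω h1 h2
    rw [norm_pow]
    exact pow_le_pow_left₀ (norm_nonneg _) ((norm_sub_le _ _).trans (add_le_add h1 h2)) 2
  have i2 : Integrable (fun ω => (A ω - B ω) ^ 2) P := by
    refine Integrable.of_bound ((hA₀.sub hB₀).pow 2).aestronglyMeasurable ((C + C) ^ 2) ?_
    filter_upwards [hAC, hBC] with ω h1 h2
    rw [norm_pow]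
    exact pow_le_pow_left₀ (norm_nonneg _) ((norm_sub_le _ _).trans (add_le_add h1 h2)) 2
  have i3 : Integrable (fun ω => (2 * (A ω - B ω)) * (U ω - A ω)) P := by
    refine Integrable.of_bound ((stronglyMeasurable_const.mul (hA₀.sub hB₀)).mul
      (hU.sub hA₀)).aestronglyMeasurable (2 * (C + C) * (C + C)) ?_
    filter_upwards [hUC, hAC, hBC] with ω h1 h2 h3
    rw [norm_mul, norm_mul, RCLike.norm_two]
    have h4 := (norm_sub_le (A ω) (B ω)).trans (add_le_add h2 h3)
    have h5 := (norm_sub_le (U ω) (A ω)).trans (add_le_add h1 h2)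
    have : 0 ≤ C + C := (norm_nonneg _).trans h4
    gcongr
  -- The factor 2(A - B) is m'-measurable and U - A has conditional mean zero given m'.
  have hcross : P[fun ω => (2 * (A ω - B ω)) * (U ω - A ω) | m] =ᵐ[P] 0 := by
    have h1 : P[fun ω => (2 * (A ω - B ω)) * (U ω - A ω) | m'] =ᵐ[P] 0 := by
      have h2 := condExp_bilin_of_stronglyMeasurable_left (μ := P) (m := m')
        (ContinuousLinearMap.mul ℝ 𝕜) (f := fun ω => 2 * (A ω - B ω))
        (g := fun ω => U ω - A ω) (stronglyMeasurable_const.mul (hA.sub hB')) i3 (hUi.sub hAi)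
      have h3 : P[fun ω => U ω - A ω | m'] =ᵐ[P] 0 := by
        have h4 := condExp_sub hUi hAi m'
        filter_upwards [h4, hUA] with ω h5 h6
        have h7 : (P[A | m']) ω = A ω := by
          rw [condExp_of_stronglyMeasurable hm' hA hAi]
        have h8 : (P[fun ω => U ω - A ω | m']) ω = (P[U | m']) ω - (P[A | m']) ω := h5
        rw [h8, h6, h7, sub_self, Pi.zero_apply]
      filter_upwards [h2, h3] with ω h4 h5
      have h6 : (P[fun ω => (2 * (A ω - B ω)) * (U ω - A ω) | m']) ω
        = (2 * (A ω - B ω)) * (P[fun ω => U ω - A ω | m']) ω := h4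
      rw [h6, h5, Pi.zero_apply, mul_zero]
    calc P[fun ω => (2 * (A ω - B ω)) * (U ω - A ω) | m]
        =ᵐ[P] P[P[fun ω => (2 * (A ω - B ω)) * (U ω - A ω) | m'] | m] :=
          (condExp_condExp_of_le hmm' hm').symm
      _ =ᵐ[P] P[(0 : Ω → 𝕜) | m] := condExp_congr_ae h1
      _ =ᵐ[P] 0 := by rw [condExp_zero]
  have e : (fun ω => (U ω - B ω) ^ 2) = ((fun ω => (U ω - A ω) ^ 2) + fun ω => (A ω - B ω) ^ 2)
      + fun ω => (2 * (A ω - B ω)) * (U ω - A ω) := by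
    funext ω
    simp only [Pi.add_apply]
    ring
  rw [e]
  filter_upwards [condExp_add (i1.add i2) i3 m, condExp_add i1 i2 m, hcross,
    condExp_condExp_of_le (μ := P) (f := fun ω => (U ω - A ω) ^ 2) hmm' hm'] with ω h1 h2 h3 h4
  rw [h1, Pi.add_apply, h2, Pi.add_apply, h3, h4, Pi.zero_apply, add_zero]

end ComplexMartingale

/-! ### The backward recursion along the martingale. -/

namespace ComplexMartingale

variable {Ω : Type*} {m₀ : MeasurableSpace Ω} {P : Measure[m₀] Ω}

theorem condExp_re_ae_eq {m : MeasurableSpace Ω} {U : Ω → ℂ} (hU : Integrable U P) :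
    P[fun ω => (U ω).re | m] =ᵐ[P] fun ω => ((P[U | m]) ω).re :=
  (Complex.reCLM.comp_condExp_comm hU).symm

theorem condExp_im_ae_eq {m : MeasurableSpace Ω} {U : Ω → ℂ} (hU : Integrable U P) :
    P[fun ω => (U ω).im | m] =ᵐ[P] fun ω => ((P[U | m]) ω).im :=
  (Complex.imCLM.comp_condExp_comm hU).symm

variable {n : ℕ} {F : Filtration (Fin (n + 1)) m₀} {Z : Fin (n + 1) → Ω → ℂ}

/-- The `k`-th term of the exponent in the error bound. -/
noncomputable def stepExponent (P : Measure[m₀] Ω) (F : Filtration (Fin (n + 1)) m₀)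
    (Z : Fin (n + 1) → Ω → ℂ) (k : Fin n) (ω : Ω) : ℝ :=
  errorExponent (R P F Z k ω) (Q P F Z k ω / 2)

theorem stepExponent_eq (k : Fin n) (ω : Ω) : stepExponent P F Z k ω
    = 1 / 6 * R P F Z k ω ^ 3 + 1 / 6 * R P F Z k ω * Q P F Z k ω
      + 5 / 8 * R P F Z k ω ^ 4 + 5 / 32 * Q P F Z k ω ^ 2 := by
  unfold stepExponent errorExponent
  ring

theorem measurable_stepExponent (k : Fin n) :
    Measurable[F k.castSucc] (stepExponent P F Z k) := by
  have hR : Measurable[F k.castSucc] (R P F Z k) := measurable_condDiam _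
  have hQ : Measurable[F k.castSucc] (Q P F Z k) :=
    (measurable_condDiam _).max (measurable_condDiam _)
  have e : stepExponent P F Z k = fun ω => 1 / 6 * R P F Z k ω ^ 3
      + 1 / 6 * R P F Z k ω * Q P F Z k ω + 5 / 8 * R P F Z k ω ^ 4
      + 5 / 32 * Q P F Z k ω ^ 2 := funext fun ω => stepExponent_eq k ω
  rw [e]
  fun_prop

theorem ae_norm_sub_sq_le {U A : Ω → ℂ} {C : ℝ} (hU : ∀ᵐ ω ∂P, ‖U ω‖ ≤ C)
    (hA : ∀ᵐ ω ∂P, ‖A ω‖ ≤ C) : ∀ᵐ ω ∂P, ‖(U ω - A ω) ^ 2‖ ≤ (C + C) ^ 2 := by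
  filter_upwards [hU, hA] with ω h1 h2
  rw [norm_pow]
  exact pow_le_pow_left₀ (norm_nonneg _) ((norm_sub_le _ _).trans (add_le_add h1 h2)) 2

theorem ae_norm_re_sub_sq_le {U A : Ω → ℂ} {C : ℝ} (hU : ∀ᵐ ω ∂P, ‖U ω‖ ≤ C)
    (hA : ∀ᵐ ω ∂P, ‖A ω‖ ≤ C) :
    ∀ᵐ ω ∂P, ‖((U ω).re - (A ω).re) ^ 2‖ ≤ (C + C) ^ 2 := by
  filter_upwards [hU, hA] with ω h1 h2
  rw [norm_pow, Real.norm_eq_abs, ← Complex.sub_re]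
  exact pow_le_pow_left₀ (abs_nonneg _)
    ((Complex.abs_re_le_norm _).trans ((norm_sub_le _ _).trans (add_le_add h1 h2))) 2

theorem ae_stepExponent_mem_Icc [IsProbabilityMeasure P] (hZ : Martingale Z F P) {C : ℝ}
    (hC : ∀ k, ∀ᵐ ω ∂P, ‖Z k ω‖ ≤ C) (k : Fin n) :
    ∀ᵐ ω ∂P, 0 ≤ stepExponent P F Z k ω
      ∧ stepExponent P F Z k ω ≤ errorExponent (2 * C) (2 * (C + C) ^ 2 / 2) := by
  have hm := F.le k.castSucc
  have hm' := F.le k.succ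
  have h1 := ae_condDiam_mem_Icc (P := P) hm (((hZ.1 k.succ).mono hm').measurable) (hC k.succ)
  have h2 := ae_condDiam_mem_Icc (P := P) hm
    ((stronglyMeasurable_condExp (μ := P) (m := F k.succ)
      (f := fun ω' => (Z (Fin.last n) ω' - Z k.succ ω') ^ 2)).mono hm').measurable
    (ae_bdd_norm_condExp_of_ae_bdd_norm (ae_norm_sub_sq_le (hC (Fin.last n)) (hC k.succ)))
  have h3 := ae_condDiam_mem_Icc (P := P) hm (C := (C + C) ^ 2)
    (Complex.measurable_ofReal.comp
      ((stronglyMeasurable_condExp (μ := P) (m := F k.succ)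
        (f := fun ω' => ((Z (Fin.last n) ω').re - (Z k.succ ω').re) ^ 2)).mono hm').measurable)
    (by
      filter_upwards [ae_bdd_norm_condExp_of_ae_bdd_norm (m := F k.succ)
        (ae_norm_re_sub_sq_le (hC (Fin.last n)) (hC k.succ))] with ω h
      rwa [Function.comp_apply, Complex.norm_real])
  filter_upwards [h1, h2, h3] with ω h1 h2 h3
  have hR0 : 0 ≤ R P F Z k ω := h1.1
  have hRC : R P F Z k ω ≤ 2 * C := h1.2
  have hQ0 : 0 ≤ Q P F Z k ω := le_max_of_le_left h2.1
  have hQC : Q P F Z k ω ≤ 2 * (C + C) ^ 2 := max_le h2.2 h3.2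
  have hQ0' : 0 ≤ Q P F Z k ω / 2 := by positivity
  have hC0 : 0 ≤ 2 * C := hR0.trans hRC
  refine ⟨errorExponent_nonneg hR0 hQ0', ?_⟩
  unfold stepExponent errorExponent
  gcongr

/-- Backward induction on k. As the index j stands for step j + 1, the condition `Fin.castSucc j <
k` selects exactly the steps up to time k. -/
theorem ae_norm_condExp_exp_sub_exp_le [IsProbabilityMeasure P] (hZ : Martingale Z F P) {C : ℝ}
    (hC : ∀ k, ∀ᵐ ω ∂P, ‖Z k ω‖ ≤ C) {T : Ω → ℝ} (hT : Measurable[F 0] T)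
    (hT' : ∀ᵐ ω ∂P, Real.exp (∑ k, stepExponent P F Z k ω) ≤ T ω) (k : Fin (n + 1)) :
    ∀ᵐ ω ∂P, ‖(P[fun ω' => Complex.exp (Z (Fin.last n) ω') | F k]) ω
        - Complex.exp (Z k ω
          + 1 / 2 * (P[fun ω' => (Z (Fin.last n) ω' - Z k ω') ^ 2 | F k]) ω)‖
      ≤ (T ω * Real.exp (-∑ j with Fin.castSucc j < k, stepExponent P F Z j ω) - 1)
        * Real.exp ((Z k ω).re
          + 1 / 2 * (P[fun ω' => ((Z (Fin.last n) ω').re - (Z k ω').re) ^ 2 | F k]) ω) := by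
  have hδ : ∀ᵐ ω ∂P, ∀ j, 0 ≤ stepExponent P F Z j ω :=
    ae_all_iff.2 fun j => (ae_stepExponent_mem_Icc hZ hC j).mono fun _ h => h.1
  have hb0 : ∀ k : Fin (n + 1), ∀ᵐ ω ∂P,
      0 ≤ T ω * Real.exp (-∑ j with Fin.castSucc j < k, stepExponent P F Z j ω) - 1 := by
    intro k
    filter_upwards [hT', hδ] with ω h1 h2
    have h3 : ∑ j with Fin.castSucc j < k, stepExponent P F Z j ω
        ≤ ∑ j, stepExponent P F Z j ω :=
      Finset.sum_le_sum_of_subset_of_nonneg (Finset.filter_subset _ _) fun j _ _ => h2 j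
    have h4 : 1 ≤ T ω * Real.exp (-∑ j with Fin.castSucc j < k, stepExponent P F Z j ω) := by
      calc (1 : ℝ) ≤ Real.exp (∑ j, stepExponent P F Z j ω)
            * Real.exp (-∑ j with Fin.castSucc j < k, stepExponent P F Z j ω) := by
            rw [← Real.exp_add]
            exact Real.one_le_exp (by linarith)
        _ ≤ _ := by gcongr
    linarith
  have hC0 : 0 ≤ C := by
    obtain ⟨ω, h⟩ := (hC 0).exists
    exact (norm_nonneg _).trans h
  have hexpC : ∀ᵐ ω ∂P, ‖Complex.exp (Z (Fin.last n) ω)‖ ≤ Real.exp C := by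
    filter_upwards [hC (Fin.last n)] with ω h
    exact (Complex.norm_exp_le_exp_norm _).trans (Real.exp_le_exp.2 h)
  have hZm : ∀ k, StronglyMeasurable[m₀] (Z k) := fun k => (hZ.1 k).mono (F.le k)
  have hexpi : Integrable (fun ω => Complex.exp (Z (Fin.last n) ω)) P :=
    Integrable.of_bound (Complex.measurable_exp.comp (hZm _).measurable).aestronglyMeasurable
      _ hexpC
  induction k using Fin.reverseInduction with
  | last =>
    filter_upwards [hb0 (Fin.last n)] with ω h
    have e1 : P[fun ω' => Complex.exp (Z (Fin.last n) ω') | F (Fin.last n)]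
        = fun ω' => Complex.exp (Z (Fin.last n) ω') :=
      condExp_of_stronglyMeasurable (F.le _)
        (Complex.continuous_exp.comp_stronglyMeasurable (hZ.1 _)) hexpi
    have e2 : (fun ω' => (Z (Fin.last n) ω' - Z (Fin.last n) ω') ^ 2) = 0 := by
      funext ω'; simp
    rw [e1, e2, condExp_zero]
    simp only [Pi.zero_apply, mul_zero, add_zero, sub_self, norm_zero]
    exact mul_nonneg h (Real.exp_nonneg _)
  | cast i ih =>
    have hm := F.le i.castSucc
    have hm' := F.le i.succ
    have hmm' : F i.castSucc ≤ F i.succ := F.mono i.castSucc_lt_succ.le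
    set X := Z i.succ with hX
    set y := P[fun ω' => (Z (Fin.last n) ω' - X ω') ^ 2 | F i.succ] with hy
    set y' := P[fun ω' => ((Z (Fin.last n) ω').re - (X ω').re) ^ 2 | F i.succ] with hy'
    set g := P[fun ω' => Complex.exp (Z (Fin.last n) ω') | F i.succ] with hg
    set b : Ω → ℝ := fun ω =>
      T ω * Real.exp (-∑ j with Fin.castSucc j < i.succ, stepExponent P F Z j ω) - 1 with hb
    -- Predictability: the exponents up to time i + 1 have indices j ≤ i and are already measurable
    -- at time i.
    have hbm : Measurable[F i.castSucc] b := by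
      refine Measurable.sub_const (Measurable.mul (hT.mono (F.mono (Fin.zero_le _)) le_rfl) ?_) _
      refine Real.measurable_exp.comp (Measurable.neg ?_)
      refine Finset.measurable_fun_sum _ fun j hj => ?_
      rw [Finset.mem_filter] at hj
      refine (measurable_stepExponent j).mono (F.mono ?_) le_rfl
      have := hj.2
      rw [Fin.lt_def] at this
      rw [Fin.le_def]
      simp only [Fin.val_castSucc, Fin.val_succ] at this ⊢
      omega
    set K := C + (C + C) ^ 2 + Real.exp C with hK
    have hK1 : C ≤ K := by have := Real.exp_pos C; have := sq_nonneg (C + C); linarith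
    have hK2 : (C + C) ^ 2 ≤ K := by have := Real.exp_pos C; linarith
    have hK3 : Real.exp C ≤ K := by have := sq_nonneg (C + C); linarith
    have sqi : Integrable (fun ω' => (Z (Fin.last n) ω' - X ω') ^ 2) P :=
      Integrable.of_bound (((hZm _).sub (hZm _)).pow 2).aestronglyMeasurable _
        (ae_norm_sub_sq_le (hC _) (hC _))
    have sqi' : Integrable (fun ω' => ((Z (Fin.last n) ω').re - (X ω').re) ^ 2) P := by
      refine Integrable.of_bound ?_ _ (ae_norm_re_sub_sq_le (hC (Fin.last n)) (hC i.succ))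
      exact (((Complex.measurable_re.comp (hZm _).measurable).sub
        (Complex.measurable_re.comp (hZm _).measurable)).pow_const 2).aestronglyMeasurable
    -- Pointwise Re(w^2) = (Re w)^2 - (Im w)^2 ≤ (Re w)^2.
    have hyy' : ∀ᵐ ω ∂P, (y ω).re ≤ y' ω := by
      have h1 := condExp_re_ae_eq (m := F i.succ) sqi
      have h2 : P[fun ω' => ((Z (Fin.last n) ω' - X ω') ^ 2).re | F i.succ] ≤ᵐ[P] y' :=
        condExp_mono sqi.re sqi' (.of_forall fun ω => by
          simp only [sq, Complex.mul_re, Complex.sub_re, Complex.sub_im]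
          nlinarith [mul_self_nonneg ((Z (Fin.last n) ω).im - (X ω).im)])
      filter_upwards [h1, h2] with ω h3 h4
      rwa [h3] at h4
    have step := ae_norm_condExp_sub_exp_le (P := P) hm (x := X) (y := y) (g := g) (y' := y')
      (b := b) (C := K) (hZm _).measurable (stronglyMeasurable_condExp.mono hm').measurable
      (stronglyMeasurable_condExp.mono hm').measurable
      (stronglyMeasurable_condExp.mono hm').measurable hbm
      ((hC _).mono fun ω h => h.trans hK1)
      ((ae_bdd_norm_condExp_of_ae_bdd_norm (ae_norm_sub_sq_le (hC _) (hC _))).mono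
        fun ω h => h.trans hK2)
      ((ae_bdd_norm_condExp_of_ae_bdd_norm hexpC).mono fun ω h => h.trans hK3)
      ((ae_bdd_norm_condExp_of_ae_bdd_norm (ae_norm_re_sub_sq_le (hC _) (hC _))).mono
        fun ω h => h.trans hK2)
      (hb0 i.succ) hyy' ih
    have hXZ : P[X | F i.castSucc] =ᵐ[P] Z i.castSucc :=
      hZ.condExp_ae_eq i.castSucc_lt_succ.le
    have hgZ : P[g | F i.castSucc]
        =ᵐ[P] P[fun ω' => Complex.exp (Z (Fin.last n) ω') | F i.castSucc] :=
      condExp_condExp_of_le hmm' hm'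
    have hv : P[fun ω' => (X ω' - (P[X | F i.castSucc]) ω') ^ 2 | F i.castSucc]
        =ᵐ[P] P[fun ω' => (X ω' - Z i.castSucc ω') ^ 2 | F i.castSucc] :=
      condExp_congr_ae (by filter_upwards [hXZ] with ω h; rw [h])
    have hv' : P[fun ω' => ((X ω').re - ((P[X | F i.castSucc]) ω').re) ^ 2 | F i.castSucc]
        =ᵐ[P] P[fun ω' => ((X ω').re - (Z i.castSucc ω').re) ^ 2 | F i.castSucc] :=
      condExp_congr_ae (by filter_upwards [hXZ] with ω h; rw [h])
    have hlast : P[Z (Fin.last n) | F i.succ] =ᵐ[P] X := hZ.condExp_ae_eq (Fin.le_last _)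
    have tot := condExp_sq_sub_ae_eq (P := P) hmm' hm' (hZm (Fin.last n)) (hZ.1 i.succ)
      (hZ.1 i.castSucc) (hC _) (hC _) (hC _) hlast
    have hre : ∀ k, ∀ᵐ ω ∂P, ‖(Z k ω).re‖ ≤ C := fun k =>
      (hC k).mono fun ω h => (Complex.abs_re_le_norm _).trans h
    have tot' := condExp_sq_sub_ae_eq (P := P) hmm' hm' (U := fun ω => (Z (Fin.last n) ω).re)
      (A := fun ω => (X ω).re) (B := fun ω => (Z i.castSucc ω).re)
      (Complex.continuous_re.comp_stronglyMeasurable (hZm _))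
      (Complex.continuous_re.comp_stronglyMeasurable (hZ.1 i.succ))
      (Complex.continuous_re.comp_stronglyMeasurable (hZ.1 i.castSucc)) (hre _) (hre _) (hre _)
      (by
        filter_upwards [condExp_re_ae_eq (m := F i.succ) (hZ.integrable (Fin.last n)), hlast]
          with ω h1 h2
        rw [h1, h2])
    filter_upwards [step, hXZ, hgZ, hv, hv', tot, tot'] with ω h1 h2 h3 h4 h5 h6 h7
    have hsum : ∑ j with Fin.castSucc j < i.succ, stepExponent P F Z j ω
        = stepExponent P F Z i ω
          + ∑ j with Fin.castSucc j < i.castSucc, stepExponent P F Z j ω := by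
      rw [← Finset.sum_insert (s := Finset.univ.filter fun j : Fin n => j.castSucc < i.castSucc)
        (a := i) (f := fun j => stepExponent P F Z j ω) (by simp)]
      refine Finset.sum_congr ?_ fun _ _ => rfl
      ext j
      simp only [Finset.mem_filter, Finset.mem_univ, true_and, Finset.mem_insert, Fin.lt_def,
        Fin.ext_iff, Fin.val_castSucc, Fin.val_succ]
      omega
    -- The coefficients were chosen so that multiplying 1 + b by e^δ removes exactly one term from
    -- the negative sum.
    have hcoef : (1 + b ω) * Real.exp (stepExponent P F Z i ω)
        = T ω * Real.exp (-∑ j with Fin.castSucc j < i.castSucc, stepExponent P F Z j ω) := by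
      simp only [hb]
      rw [hsum, add_sub_cancel, mul_assoc, ← Real.exp_add]
      congr 2
      ring
    have hδi : errorExponent (condDiam (F i.castSucc) P X ω)
        (max (condDiam (F i.castSucc) P y ω)
          (condDiam (F i.castSucc) P (fun ω' => (y' ω' : ℂ)) ω) / 2)
        = stepExponent P F Z i ω := rfl
    rw [hδi, hcoef, h2, h3, h4, h5] at h1
    rw [h6, h7, mul_add, mul_add, ← add_assoc, ← add_assoc]
    exact h1

end ComplexMartingale

/-! ### From the recursion to the stated form. -/

namespace ComplexMartingale

variable {Ω : Type*} {m₀ : MeasurableSpace Ω} {P : Measure[m₀] Ω}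
  {n : ℕ} {F : Filtration (Fin (n + 1)) m₀} {Z : Fin (n + 1) → Ω → ℂ}

theorem ae_exp_sum_stepExponent_le_condEssSup [IsProbabilityMeasure P] (hZ : Martingale Z F P)
    {C : ℝ} (hC : ∀ k, ∀ᵐ ω ∂P, ‖Z k ω‖ ≤ C) :
    ∀ᵐ ω ∂P, Real.exp (∑ k, stepExponent P F Z k ω)
      ≤ condEssSup (F 0) P (fun ω' => Real.exp (∑ k, stepExponent P F Z k ω')) ω := by
  refine (ae_le_condEssSup (F.le 0)
    (C := Real.exp (∑ _k : Fin n, errorExponent (2 * C) (2 * (C + C) ^ 2 / 2))) ?_ ?_).1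
  · refine Measurable.aestronglyMeasurable (Real.measurable_exp.comp ?_)
    exact Finset.measurable_fun_sum _ fun k _ =>
      (measurable_stepExponent k).mono (F.le _) le_rfl
  · filter_upwards [ae_all_iff.2 fun k => ae_stepExponent_mem_Icc hZ hC k] with ω h
    rw [abs_of_pos (Real.exp_pos _)]
    exact Real.exp_le_exp.2 (Finset.sum_le_sum fun k _ => (h k).2)

variable {m : MeasurableSpace Ω}

theorem condPseudoVar_ae_eq {U A : Ω → ℂ} (hA : P[U | m] =ᵐ[P] A) :
    condPseudoVar m P U =ᵐ[P] P[fun ω => (U ω - A ω) ^ 2 | m] :=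
  condExp_congr_ae (by filter_upwards [hA] with ω h; rw [h])

theorem condVar_re_ae_eq {U A : Ω → ℂ} (hU : Integrable U P) (hA : P[U | m] =ᵐ[P] A) :
    condVar m (fun ω => (U ω).re) P =ᵐ[P] P[fun ω => ((U ω).re - (A ω).re) ^ 2 | m] :=
  condExp_congr_ae (by
    filter_upwards [condExp_re_ae_eq (m := m) hU, hA] with ω h1 h2
    simp only [Pi.pow_apply, Pi.sub_apply]
    rw [h1, h2])

theorem condVar_im_ae_eq {U A : Ω → ℂ} (hU : Integrable U P) (hA : P[U | m] =ᵐ[P] A) :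
    condVar m (fun ω => (U ω).im) P =ᵐ[P] P[fun ω => ((U ω).im - (A ω).im) ^ 2 | m] :=
  condExp_congr_ae (by
    filter_upwards [condExp_im_ae_eq (m := m) hU, hA] with ω h1 h2
    simp only [Pi.pow_apply, Pi.sub_apply]
    rw [h1, h2])

/-- The real part of the conditional pseudovariance is the difference of the conditional
variances of the real and the imaginary part. -/
theorem re_condPseudoVar_ae_eq [IsProbabilityMeasure P] {U A : Ω → ℂ} {C : ℝ}
    (hU : StronglyMeasurable[m₀] U) (hA : StronglyMeasurable[m₀] A)
    (hUC : ∀ᵐ ω ∂P, ‖U ω‖ ≤ C) (hAC : ∀ᵐ ω ∂P, ‖A ω‖ ≤ C) (hUA : P[U | m] =ᵐ[P] A) :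
    ∀ᵐ ω ∂P, (condPseudoVar m P U ω).re
      = condVar m (fun ω' => (U ω').re) P ω - condVar m (fun ω' => (U ω').im) P ω := by
  have hUi : Integrable U P := Integrable.of_bound hU.aestronglyMeasurable C hUC
  have i1 : Integrable (fun ω => (U ω - A ω) ^ 2) P :=
    Integrable.of_bound ((hU.sub hA).pow 2).aestronglyMeasurable _ (ae_norm_sub_sq_le hUC hAC)
  have i2 : Integrable (fun ω => ((U ω).re - (A ω).re) ^ 2) P := by
    refine Integrable.of_bound ?_ _ (ae_norm_re_sub_sq_le hUC hAC)
    exact (((Complex.measurable_re.comp hU.measurable).sub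
      (Complex.measurable_re.comp hA.measurable)).pow_const 2).aestronglyMeasurable
  have e : (fun ω => ((U ω).im - (A ω).im) ^ 2)
      = fun ω => ((U ω).re - (A ω).re) ^ 2 - ((U ω - A ω) ^ 2).re := by
    funext ω
    simp only [sq, Complex.mul_re, Complex.sub_re, Complex.sub_im]
    ring
  have h1 : P[fun ω => ((U ω).im - (A ω).im) ^ 2 | m]
      =ᵐ[P] P[fun ω => ((U ω).re - (A ω).re) ^ 2 | m] - P[fun ω => ((U ω - A ω) ^ 2).re | m] := by
    rw [e]
    exact condExp_sub i2 i1.re m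
  filter_upwards [condPseudoVar_ae_eq hUA, condVar_re_ae_eq hUi hUA, condVar_im_ae_eq hUi hUA,
    h1, condExp_re_ae_eq (m := m) i1] with ω h2 h3 h4 h5 h6
  rw [h2, h3, h4, h5, Pi.sub_apply, h6]
  ring

end ComplexMartingale

theorem mainTheorem2 {Ω : Type*} {m₀ : MeasurableSpace Ω} (P : Measure[m₀] Ω)
    [IsProbabilityMeasure P] (n : ℕ) (F : Filtration (Fin (n + 1)) m₀)
    (Z : Fin (n + 1) → Ω → ℂ) (hZ : Martingale Z F P)
    (hbdd : ∃ C : ℝ, ∀ k, ∀ᵐ ω ∂P, ‖Z k ω‖ ≤ C) :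
    ∃ L L' : Ω → ℂ, Measurable[F 0] L ∧ Measurable[F 0] L' ∧
      (∀ᵐ ω ∂P,
        (P[fun ω' => Complex.exp (Z (Fin.last n) ω') | F 0]) ω
          = Complex.exp (Z 0 ω
              + 1 / 2 * ComplexMartingale.condPseudoVar (F 0) P (Z (Fin.last n)) ω)
            + L ω * (Real.exp ((Z 0 ω).re
              + 1 / 2 * condVar (F 0) (fun ω' => (Z (Fin.last n) ω').re) P ω) : ℂ)) ∧
      (∀ᵐ ω ∂P,
        (P[fun ω' => Complex.exp (Z (Fin.last n) ω') | F 0]) ω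
          = Complex.exp (Z 0 ω
              + 1 / 2 * ComplexMartingale.condPseudoVar (F 0) P (Z (Fin.last n)) ω)
            * (1 + L' ω * (Real.exp
              (1 / 2 * condVar (F 0) (fun ω' => (Z (Fin.last n) ω').im) P ω) : ℂ))) ∧
      (∀ᵐ ω ∂P, ‖L ω‖ = ‖L' ω‖) ∧
      (∀ᵐ ω ∂P, ‖L' ω‖ ≤
        ComplexMartingale.condEssSup (F 0) P (fun ω' => Real.exp (∑ k : Fin n,
          (1 / 6 * ComplexMartingale.R P F Z k ω' ^ 3
            + 1 / 6 * ComplexMartingale.R P F Z k ω' * ComplexMartingale.Q P F Z k ω'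
            + 5 / 8 * ComplexMartingale.R P F Z k ω' ^ 4
            + 5 / 32 * ComplexMartingale.Q P F Z k ω' ^ 2))) ω - 1) := by
  obtain ⟨C, hC⟩ := hbdd
  let A : Ω → ℂ := fun ω => Complex.exp (Z 0 ω
    + 1 / 2 * ComplexMartingale.condPseudoVar (F 0) P (Z (Fin.last n)) ω)
  let D : Ω → ℂ := fun ω => (P[fun ω' => Complex.exp (Z (Fin.last n) ω') | F 0]) ω - A ω
  let vr : Ω → ℝ := condVar (F 0) (fun ω' => (Z (Fin.last n) ω').re) P
  let vi : Ω → ℝ := condVar (F 0) (fun ω' => (Z (Fin.last n) ω').im) P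
  have hZ0 : Measurable[F 0] (Z 0) := (hZ.1 0).measurable
  have hA : Measurable[F 0] A := Complex.measurable_exp.comp
    (hZ0.add (Measurable.const_mul stronglyMeasurable_condExp.measurable _))
  have hD : Measurable[F 0] D := stronglyMeasurable_condExp.measurable.sub hA
  have hvr : Measurable[F 0] vr := stronglyMeasurable_condVar.measurable
  have hvi : Measurable[F 0] vi := stronglyMeasurable_condVar.measurable
  have hlast : P[Z (Fin.last n) | F 0] =ᵐ[P] Z 0 := hZ.condExp_ae_eq (Fin.zero_le _)
  have hZm : ∀ k, StronglyMeasurable[m₀] (Z k) := fun k => (hZ.1 k).mono (F.le k)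
  -- Since the real part of the pseudovariance is the variance of the real part minus that of the
  -- imaginary part, the two error scales agree in absolute value. Hence |L| = |L'|.
  have hnorm : ∀ᵐ ω ∂P, Real.exp ((Z 0 ω).re + 1 / 2 * vr ω)
      = ‖A ω‖ * Real.exp (1 / 2 * vi ω) := by
    filter_upwards [ComplexMartingale.re_condPseudoVar_ae_eq (hZm (Fin.last n)) (hZm 0)
      (hC _) (hC _) hlast] with ω h
    simp only [A]
    rw [Complex.norm_exp, ← Real.exp_add, Complex.add_re,
      show (1 / 2 * ComplexMartingale.condPseudoVar (F 0) P (Z (Fin.last n)) ω).re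
        = 1 / 2 * (ComplexMartingale.condPseudoVar (F 0) P (Z (Fin.last n)) ω).re by simp, h]
    congr 1
    simp only [vr, vi]
    ring
  have hLL' : ∀ᵐ ω ∂P, ‖D ω / (Real.exp ((Z 0 ω).re + 1 / 2 * vr ω) : ℂ)‖
      = ‖D ω / (A ω * (Real.exp (1 / 2 * vi ω) : ℂ))‖ := by
    filter_upwards [hnorm] with ω h
    rw [norm_div, norm_div, norm_mul, Complex.norm_real, Complex.norm_real,
      Real.norm_of_nonneg (Real.exp_nonneg _), Real.norm_of_nonneg (Real.exp_nonneg _), h]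
  -- L and L' are obtained by solving the two equations; the denominators never vanish, so both
  -- equations hold at every ω.
  refine ⟨fun ω => D ω / (Real.exp ((Z 0 ω).re + 1 / 2 * vr ω) : ℂ),
    fun ω => D ω / (A ω * (Real.exp (1 / 2 * vi ω) : ℂ)), ?_, ?_, ?_, ?_, hLL', ?_⟩
  · exact hD.div (Complex.measurable_ofReal.comp (Real.measurable_exp.comp
      ((Complex.measurable_re.comp hZ0).add (hvr.const_mul _))))
  · exact hD.div (hA.mul (Complex.measurable_ofReal.comp (Real.measurable_exp.comp
      (hvi.const_mul _))))
  · refine .of_forall fun ω => ?_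
    have h0 : (Real.exp ((Z 0 ω).re + 1 / 2 * vr ω) : ℂ) ≠ 0 :=
      Complex.ofReal_ne_zero.2 (Real.exp_pos _).ne'
    have h1 := div_mul_cancel₀ (D ω) h0
    simp only [vr] at h1 ⊢
    rw [h1]
    exact (add_sub_cancel _ _).symm
  · refine .of_forall fun ω => ?_
    have h0 : (Real.exp (1 / 2 * vi ω) : ℂ) ≠ 0 :=
      Complex.ofReal_ne_zero.2 (Real.exp_pos _).ne'
    have hA0 : A ω ≠ 0 := Complex.exp_ne_zero _
    have h1 : A ω * (1 + D ω / (A ω * (Real.exp (1 / 2 * vi ω) : ℂ))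
        * (Real.exp (1 / 2 * vi ω) : ℂ)) = A ω + D ω := by
      field_simp
    refine Eq.trans ?_ h1.symm
    exact (add_sub_cancel _ _).symm
  · have hT := ComplexMartingale.ae_exp_sum_stepExponent_le_condEssSup hZ hC
    have hmain := ComplexMartingale.ae_norm_condExp_exp_sub_exp_le hZ hC
      (ComplexMartingale.measurable_condEssSup _) hT 0
    filter_upwards [hLL', hmain, ComplexMartingale.condPseudoVar_ae_eq hlast,
      ComplexMartingale.condVar_re_ae_eq (hZ.integrable _) hlast] with ω h1 h2 h3 h4
    rw [← h1, norm_div, Complex.norm_real, Real.norm_of_nonneg (Real.exp_nonneg _),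
      div_le_iff₀ (Real.exp_pos _)]
    simp only [← ComplexMartingale.stepExponent_eq]
    -- At time 0 no step has been taken, so the coefficient reduces to T - 1.
    have h5 : ∑ j with Fin.castSucc j < (0 : Fin (n + 1)),
        ComplexMartingale.stepExponent P F Z j ω = 0 := by
      refine Finset.sum_eq_zero fun j hj => ?_
      exact absurd (Finset.mem_filter.1 hj).2 (Fin.not_lt_zero _)
    rw [h5, neg_zero, Real.exp_zero, mul_one, ← h3, ← h4] at h2
    exact h2
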